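/- Let $p\ge 1$ be an integer and let $t\subset\mathbb{R}^3$ be a non-degenerate tetrahedron with vertices $x_1,\dots,x_4$. For each edge $e$ of $t$ let $\tau_e$ be a unit tangent vector, and for each face $f$ of $t$ let $\nu_f$ be a unit normal vector (either orientation). For a simplex $s$ let $P_k(s)$ be the space of polynomial functions of degree at most $k$ on $s$, with $P_k(s)=0$ for $k<0$. For an integer $r$ put $$P_r^-\Lambda^1(f)=\{\,a+b\,\nu_f\times(x-x_f)\;:\; a \text{ a tangential vector field on } f \text{ with components in } P_{r-1}(f),\ b\in P_{r-1}(f)\,\}$$ (the Nédélec space of the first kind on $f$; $x_f$ is any fixed point of $f$, and the space does not depend on it), and $$P_r^-\Lambda^2(t)=\{\,a+b\,x\;:\;a\in P_{r-1}(t)^3,\ b\in P_{r-1}(t)\,\}$$ (the Raviart--Thomas space on $t$). Then the following degrees of freedom are unisolvent on $P_p(t)^3$: 1. the vertex values $u(x_i)\in\mathbb{R}^3$, $i=1,\dots,4$; 2. the tangential edge moments $\int_e (u\cdot\tau_e)\,q\,ds$, $q\in P_{p-2}(e)$, for each of the six edges $e$; 3. the face moments $\int_f (u\times\nu_f)\cdot\omega\,dS$,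 $\omega\in P_{p-1}^-\Lambda^1(f)$, for each of the four faces $f$; 4. the interior moments $\int_t u\cdot\eta\,dx$, $\eta\in P_{p-2}^-\Lambda^2(t)$. That is, for all vectors $a_i\in\mathbb{R}^3$ and all linear functionals $b_e$ on $P_{p-2}(e)$, $c_f$ on $P^-_{p-1}\Lambda^1(f)$ and $d$ on $P^-_{p-2}\Lambda^2(t)$, there is exactly one $u\in P_p(t)^3$ such that $u(x_i)=a_i$ for all $i$, $\int_e (u\cdot\tau_e)q\,ds=b_e(q)$ for all $e$ and $q$, $\int_f (u\times\nu_f)\cdot\omega\,dS=c_f(\omega)$ for all $f$ and $\omega$, and $\int_t u\cdot\eta\,dx=d(\eta)$ for all $\eta$. -/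

import Mathlib

open MeasureTheory
open scoped Matrix

namespace HermiteCurl

/-- Three-dimensional Euclidean space. -/
abbrev E3 := EuclideanSpace ℝ (Fin 3)

/-- The vector product of `ℝ³`. -/
noncomputable def cross (a b : E3) : E3 := WithLp.toLp 2 (a.ofLp ⨯₃ b.ofLp)

/-- `P_k(S)`: the restrictions to `S ⊆ ℝ³` of the real polynomials of total degree at most `k`.
For negative `k` this is the zero space. -/
noncomputable def polyFun (k : ℤ) (S : Set E3) : Submodule ℝ (S → ℝ) where
  carrier := {g | ∃ q : MvPolynomial (Fin 3) ℝ, (∀ m ∈ q.support, (m.degree : ℤ) ≤ k) ∧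
    ∀ x : S, g x = MvPolynomial.eval (fun i => x.1 i) q}
  zero_mem' := ⟨0, by simp, by simp⟩
  add_mem' := by
    classical
    rintro g h ⟨q, hq, hg⟩ ⟨r, hr, hh⟩
    refine ⟨q + r, fun m hm => ?_, fun x => by simp [hg, hh]⟩
    rcases Finset.mem_union.1 (MvPolynomial.support_add hm) with h1 | h1
    exacts [hq m h1, hr m h1]
  smul_mem' := by
    rintro c g ⟨q, hq, hg⟩
    refine ⟨c • q, fun m hm => hq m (MvPolynomial.support_smul hm), fun x => ?_⟩
    simp [hg, MvPolynomial.smul_eval]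

/-- The vector fields on `S` with components in `P_k(S)`. -/
def polyField (k : ℤ) (S : Set E3) : Submodule ℝ (S → E3) where
  carrier := {v | ∀ i, (fun x => v x i) ∈ polyFun k S}
  zero_mem' := fun _ => (polyFun k S).zero_mem
  add_mem' := fun hv hw i => (polyFun k S).add_mem (hv i) (hw i)
  smul_mem' := fun c _ hv i => (polyFun k S).smul_mem c (hv i)

/-- The vector fields on `S` with values in the linear subspace `W`. -/
def fieldsIn (W : Submodule ℝ E3) (S : Set E3) : Submodule ℝ (S → E3) where
  carrier := {v | ∀ x, v x ∈ W}
  zero_mem' := fun _ => W.zero_mem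
  add_mem' := fun hv hw x => W.add_mem (hv x) (hw x)
  smul_mem' := fun c _ hv x => W.smul_mem c (hv x)

/-- Multiplication of scalar functions on `S` by the fixed vector field `w`. -/
noncomputable def mulField {S : Set E3} (w : S → E3) : (S → ℝ) →ₗ[ℝ] (S → E3) where
  toFun b := fun x => b x • w x
  map_add' a b := by ext1 x; exact add_smul (a x) (b x) (w x)
  map_smul' c b := by ext1 x; exact mul_smul c (b x) (w x)

/-- The closed simplex (segment, triangle, tetrahedron) spanned by the vertices of `s`. -/
abbrev body {d : ℕ} (s : Affine.Simplex ℝ E3 d) : Set E3 := s.closedInterior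

/-- The linear space of directions tangent to `s`. -/
noncomputable def tangentDir {d : ℕ} (s : Affine.Simplex ℝ E3 d) : Submodule ℝ E3 :=
  (affineSpan ℝ (Set.range s.points)).direction

/-- `P_r^- Λ^1(f)` on a triangle `f` with unit normal `ν`, through proxy fields: the Nédélec
space of the first kind, consisting of the fields `a + b • (ν × (x - x₀))` with `a` a tangential
vector field on `f` of degree at most `r - 1` and `b ∈ P_{r-1}(f)`. The space does not depend on
the sign of `ν` or on the base point `x₀ ∈ f`. -/
noncomputable def nedelecFace (r : ℤ) (f : Affine.Simplex ℝ E3 2) (ν : E3) :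
    Submodule ℝ (body f → E3) :=
  (polyField (r - 1) (body f) ⊓ fieldsIn (tangentDir f) (body f)) ⊔
    (polyFun (r - 1) (body f)).map (mulField fun x => cross ν (x.1 - f.points 0))

/-- `P_r^- Λ^2(t)` on a tetrahedron `t`, through proxy fields: the Raviart-Thomas space of the
fields `a + b • x` with `a ∈ P_{r-1}(t)³` and `b ∈ P_{r-1}(t)`. -/
noncomputable def raviartThomas (r : ℤ) (t : Affine.Simplex ℝ E3 3) :
    Submodule ℝ (body t → E3) :=
  polyField (r - 1) (body t) ⊔ (polyFun (r - 1) (body t)).map (mulField fun x => x.1)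

/-- The edges of a tetrahedron, as two-element sets of vertex labels. -/
abbrev EdgeIdx := {e : Finset (Fin 4) // e.card = 2}

/-- The faces of a tetrahedron, as three-element sets of vertex labels. -/
abbrev FaceIdx := {f : Finset (Fin 4) // f.card = 3}

/-- An edge of `t`. -/
noncomputable abbrev edge (t : Affine.Simplex ℝ E3 3) (e : EdgeIdx) : Affine.Simplex ℝ E3 1 := t.face e.2

/-- A face of `t`. -/
noncomputable abbrev face (t : Affine.Simplex ℝ E3 3) (f : FaceIdx) : Affine.Simplex ℝ E3 2 := t.face f.2

/-- The inclusion of an edge in `t`. -/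
noncomputable def edgeIncl (t : Affine.Simplex ℝ E3 3) (e : EdgeIdx) : body (edge t e) → body t :=
  Set.inclusion (t.closedInterior_face_subset_closedInterior e.2)

/-- The inclusion of a face in `t`. -/
noncomputable def faceIncl (t : Affine.Simplex ℝ E3 3) (f : FaceIdx) : body (face t f) → body t :=
  Set.inclusion (t.closedInterior_face_subset_closedInterior f.2)

/-- The value `u(x_i)` at the vertex `x_i`. -/
def vertexDof (t : Affine.Simplex ℝ E3 3) (u : body t → E3) (i : Fin 4) : E3 :=
  u ⟨t.points i, t.point_mem_closedInterior i⟩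

/-- `∫_e (u · τ) q`, with respect to arc length. -/
noncomputable def edgeDof (t : Affine.Simplex ℝ E3 3) (u : body t → E3) (e : EdgeIdx) (τ : E3)
    (q : body (edge t e) → ℝ) : ℝ :=
  ∫ x, inner ℝ (u (edgeIncl t e x)) τ * q x ∂μHE[1]

/-- `∫_f (u × ν) · ω`, with respect to surface area. -/
noncomputable def faceDof (t : Affine.Simplex ℝ E3 3) (u : body t → E3) (f : FaceIdx) (ν : E3)
    (ω : body (face t f) → E3) : ℝ :=
  ∫ x, inner ℝ (cross (u (faceIncl t f x)) ν) (ω x) ∂μHE[2]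

/-- `∫_t u · η`, with respect to volume. -/
noncomputable def cellDof (t : Affine.Simplex ℝ E3 3) (u : body t → E3) (η : body t → E3) : ℝ :=
  ∫ x, inner ℝ (u x) (η x) ∂(volume.comap Subtype.val)

end HermiteCurl

/-! The degrees of freedom form a linear map on P_p(t)³ whose target has dimension at most dim
P_p(t)³. Hence injectivity implies bijectivity (`dofLin_bijective`), and only upper bounds for the
dimensions of the Nédélec and Raviart-Thomas spaces are needed.

For injectivity, let all degrees of freedom of u vanish. The tangential part of u is shown to vanish
on edges, then on faces, then on t, where every direction is tangential. On an edge, u · τ vanishes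
at both ends, so it equals λ₀λ₁h with h of degree p - 2, and testing with h gives h = 0
(`eq_zero_of_segment`).

On a face or on t, affine coordinates y over the reference simplex are used, and u is replaced by
its covariant components U_i = u · (x_i - x_0). The lower-dimensional faces give U zero tangential
trace, and the moments give ∫ Σ U_i (A_i + y_i B) = 0. The curl is removed first. On a triangle put
ρ = rot U; testing with the rotated gradient of ρ and integrating by parts gives ∫ ρ² = 0
(`eq_zero_of_triangle`). On a tetrahedron this choice would have degree p - 2, one too many; but the
trace condition makes the i-th component of curl U equal to y_i w_i with w_i of degree p - 2, so
curl w is admissible and ∫ Σ y_i w_i² = 0 (`eq_zero_of_tetrahedron`).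

Now U = ∇φ, and φ is constant on the boundary, say zero, so φ = (∏ λ_j) ψ. With B chosen so that
div(yB) = ψ, the radial moments give ∫ (∏ λ_j) ψ² = 0 and U = 0 (`eq_zero_of_closed`). The boundary
terms are handled algebraically by `refInt_div_eq_zero`, through divisibility by barycentric
coordinates. -/

namespace HermiteCurl

open MvPolynomial

/-! ### Polynomials of bounded degree, Euler's operator and the Poincaré lemma. -/

section Algebra

variable {d : ℕ} {k l : ℤ}

/-- The polynomials of total degree at most `k` in `d` variables. -/
noncomputable def polyLE (d : ℕ) (k : ℤ) : Submodule ℝ (MvPolynomial (Fin d) ℝ) :=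
  restrictSupport ℝ {m | (m.degree : ℤ) ≤ k}

lemma mem_polyLE {q : MvPolynomial (Fin d) ℝ} :
    q ∈ polyLE d k ↔ ∀ m ∈ q.support, (m.degree : ℤ) ≤ k := Iff.rfl

lemma monomial_mem_polyLE {m : Fin d →₀ ℕ} (h : (m.degree : ℤ) ≤ k) (a : ℝ) :
    monomial m a ∈ polyLE d k :=
  (monomial_mem_restrictSupport ℝ).2 (Or.inl h)

lemma polyLE_mono (h : k ≤ l) : polyLE d k ≤ polyLE d l :=
  restrictSupport_mono ℝ fun _ hm => le_trans hm h

lemma polyLE_le {S : Submodule ℝ (MvPolynomial (Fin d) ℝ)}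
    (h : ∀ m : Fin d →₀ ℕ, (m.degree : ℤ) ≤ k → monomial m 1 ∈ S) : polyLE d k ≤ S := by
  rw [polyLE, restrictSupport_eq_span, Submodule.span_le]
  rintro _ ⟨m, hm, rfl⟩
  exact h m hm

lemma degree_le_totalDegree {q : MvPolynomial (Fin d) ℝ} {m : Fin d →₀ ℕ} (hm : m ∈ q.support) :
    m.degree ≤ q.totalDegree := by
  have := le_totalDegree hm
  rwa [Finsupp.sum, ← Finsupp.degree_apply] at this

lemma mem_polyLE_iff {q : MvPolynomial (Fin d) ℝ} (hq : q ≠ 0) :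
    q ∈ polyLE d k ↔ (q.totalDegree : ℤ) ≤ k := by
  rw [mem_polyLE]
  constructor
  · intro h
    obtain ⟨m, hm, e⟩ := Finset.exists_mem_eq_sup q.support (support_nonempty.2 hq)
      (fun s => s.sum fun _ e => e)
    have : q.totalDegree = m.degree := by
      rw [Finsupp.degree_apply]; exact e
    rw [this]; exact h m hm
  · intro h m hm
    exact le_trans (by exact_mod_cast degree_le_totalDegree hm) h

lemma C_mem_polyLE (a : ℝ) (h : 0 ≤ k) : C a ∈ polyLE d k :=
  monomial_mem_polyLE (by simpa using h) a

lemma X_mem_polyLE (i : Fin d) (h : 1 ≤ k) : (X i : MvPolynomial (Fin d) ℝ) ∈ polyLE d k :=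
  monomial_mem_polyLE (by simpa using h) 1

lemma mul_mem_polyLE {q r : MvPolynomial (Fin d) ℝ} (hq : q ∈ polyLE d k) (hr : r ∈ polyLE d l) :
    q * r ∈ polyLE d (k + l) := by
  classical
  intro m hm
  obtain ⟨a, ha, b, hb, rfl⟩ := Finset.mem_add.1 (support_mul q r hm)
  have h1 := hq ha
  have h2 := hr hb
  simp only [Set.mem_ofPred_eq, map_add, Nat.cast_add] at *
  omega

lemma pderiv_mem_polyLE {q : MvPolynomial (Fin d) ℝ} (hq : q ∈ polyLE d k) (i : Fin d) :
    pderiv i q ∈ polyLE d (k - 1) := by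
  rw [mem_polyLE] at hq ⊢
  intro m hm
  rw [mem_support_iff, coeff_pderiv] at hm
  have h1 := hq _ (mem_support_iff.2 (left_ne_zero_of_mul hm))
  simp only [map_add, Finsupp.degree_single, Nat.cast_add, Nat.cast_one] at *
  omega

lemma prod_mem_polyLE {ι : Type*} (s : Finset ι) (f : ι → MvPolynomial (Fin d) ℝ) (n : ι → ℕ)
    (h : ∀ i ∈ s, f i ∈ polyLE d (n i)) : ∏ i ∈ s, f i ∈ polyLE d (∑ i ∈ s, (n i : ℤ)) := by
  classical
  induction s using Finset.induction_on with
  | empty => simpa using C_mem_polyLE (d := d) 1 le_rfl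
  | insert a s ha ih =>
    rw [Finset.prod_insert ha, Finset.sum_insert ha]
    exact mul_mem_polyLE (h a (Finset.mem_insert_self a s))
      (ih fun i hi => h i (Finset.mem_insert_of_mem hi))

lemma pow_mem_polyLE {q : MvPolynomial (Fin d) ℝ} (hq : q ∈ polyLE d 1) (n : ℕ) :
    q ^ n ∈ polyLE d n := by
  induction n with
  | zero => simpa using C_mem_polyLE (d := d) 1 le_rfl
  | succ n ih => rw [pow_succ, Nat.cast_succ]; exact mul_mem_polyLE ih hq

/-- Affine substitutions do not raise the degree. -/
lemma aeval_mem_polyLE {d' : ℕ} {f : Fin d → MvPolynomial (Fin d') ℝ}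
    (hf : ∀ i, f i ∈ polyLE d' 1) {q : MvPolynomial (Fin d) ℝ} (hq : q ∈ polyLE d k) :
    aeval f q ∈ polyLE d' k := by
  revert q
  change polyLE d k ≤ (polyLE d' k).comap (aeval f).toLinearMap
  refine polyLE_le fun m hm => ?_
  simp only [Submodule.mem_comap, AlgHom.toLinearMap_apply, aeval_monomial, map_one, one_mul]
  refine polyLE_mono ?_ (prod_mem_polyLE _ _ m fun i _ => pow_mem_polyLE (hf i) (m i))
  rw [Finsupp.degree_apply] at hm
  exact_mod_cast hm

/-- The operator dividing the homogeneous component of degree `n` by `n + c`. -/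
noncomputable def degDiv (d c : ℕ) : MvPolynomial (Fin d) ℝ →ₗ[ℝ] MvPolynomial (Fin d) ℝ :=
  (basisMonomials (Fin d) ℝ).constr ℝ fun m => monomial m (1 / ((m.degree : ℝ) + c))

lemma degDiv_monomial (c : ℕ) (m : Fin d →₀ ℕ) (a : ℝ) :
    degDiv d c (monomial m a) = monomial m (a / ((m.degree : ℝ) + c)) := by
  have h : monomial m a = a • basisMonomials (Fin d) ℝ m := by
    simp [smul_monomial]
  rw [h, map_smul, degDiv, Module.Basis.constr_basis, smul_monomial]
  congr 1
  simp [div_eq_mul_inv]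

lemma degDiv_mem_polyLE (c : ℕ) {q : MvPolynomial (Fin d) ℝ} (hq : q ∈ polyLE d k) :
    degDiv d c q ∈ polyLE d k := by
  revert q
  change polyLE d k ≤ (polyLE d k).comap (degDiv d c)
  refine polyLE_le fun m hm => ?_
  rw [Submodule.mem_comap, degDiv_monomial]
  exact monomial_mem_polyLE hm _

/-- Euler's identity for monomials. -/
lemma sum_X_mul_pderiv_monomial (m : Fin d →₀ ℕ) (a : ℝ) :
    ∑ i, X i * pderiv i (monomial m a) = monomial m (m.degree * a) := by
  rw [(isHomogeneous_monomial a rfl : (monomial m a).IsHomogeneous m.degree).sum_X_mul_pderiv,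
    ← map_nsmul, nsmul_eq_mul]

/-- The Euler operator multiplies degree n by n, so adding c makes it diagonal with eigenvalues n +
c, nonzero for c > 0. This lemma and the next say that `degDiv d c` is its two-sided inverse. -/
lemma degDiv_euler {c : ℕ} (hc : 0 < c) (q : MvPolynomial (Fin d) ℝ) :
    degDiv d c ((c : ℝ) • q + ∑ i, X i * pderiv i q) = q := by
  induction q using MvPolynomial.induction_on' with
  | monomial m a =>
    rw [sum_X_mul_pderiv_monomial, smul_monomial, ← map_add, degDiv_monomial]
    congr 1
    have : (m.degree : ℝ) + c ≠ 0 := by positivity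
    rw [div_eq_iff this, smul_eq_mul]; ring
  | add p q hp hq =>
    have : (c : ℝ) • (p + q) + ∑ i, X i * pderiv i (p + q) =
      ((c : ℝ) • p + ∑ i, X i * pderiv i p) + ((c : ℝ) • q + ∑ i, X i * pderiv i q) := by
      simp only [map_add, mul_add, Finset.sum_add_distrib, smul_add]; abel
    rw [this, map_add, hp, hq]

lemma euler_degDiv {c : ℕ} (hc : 0 < c) (q : MvPolynomial (Fin d) ℝ) :
    (c : ℝ) • degDiv d c q + ∑ i, X i * pderiv i (degDiv d c q) = q := by
  induction q using MvPolynomial.induction_on' with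
  | monomial m a =>
    rw [degDiv_monomial, sum_X_mul_pderiv_monomial, smul_monomial, ← map_add]
    congr 1
    have : (m.degree : ℝ) + c ≠ 0 := by positivity
    rw [smul_eq_mul, ← add_mul, add_comm, mul_div_cancel₀ _ this]
  | add p q hp hq =>
    simp only [map_add, mul_add, Finset.sum_add_distrib, smul_add]
    nth_rewrite 3 [← hp]
    nth_rewrite 3 [← hq]
    abel

/-- Differentiation lowers the degree by one, so the divisor n becomes (n - 1) + 1. -/
lemma pderiv_degDiv (j : Fin d) (q : MvPolynomial (Fin d) ℝ) :
    pderiv j (degDiv d 0 q) = degDiv d 1 (pderiv j q) := by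
  induction q using MvPolynomial.induction_on' with
  | monomial m a =>
    rw [degDiv_monomial, pderiv_monomial, pderiv_monomial, degDiv_monomial]
    rcases Nat.eq_zero_or_pos (m j) with h | h
    -- Both sides are zero here; this covers the constant monomial, where `degDiv d 0` divides by
    -- zero.
    · simp [h]
    · congr 1
      have : Finsupp.single j 1 ≤ m := by simpa [Finsupp.single_le_iff, Nat.one_le_iff_ne_zero, Nat.pos_iff_ne_zero] using h
      have e : (m - Finsupp.single j 1).degree + 1 = m.degree := by
        conv_rhs => rw [← tsub_add_cancel_of_le this, map_add, Finsupp.degree_single]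
      rw [← e]; push_cast; ring
  | add p q hp hq => simp only [map_add, hp, hq]

/-- Poincaré's lemma for polynomials. -/
lemma exists_potential {U : Fin d → MvPolynomial (Fin d) ℝ} (hU : ∀ i, U i ∈ polyLE d k)
    (hc : ∀ i j, pderiv i (U j) = pderiv j (U i)) :
    ∃ φ ∈ polyLE d (k + 1), ∀ i, pderiv i φ = U i := by
  -- This is the homotopy formula φ(x) = ∫₀¹ x · U(sx) ds: a degree n component of x · U is divided
  -- by n.
  refine ⟨degDiv d 0 (∑ i, X i * U i), degDiv_mem_polyLE _ (Submodule.sum_mem _ fun i _ => ?_),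
    fun j => ?_⟩
  · rw [add_comm]; exact mul_mem_polyLE (X_mem_polyLE i le_rfl) (hU i)
  · rw [pderiv_degDiv]
    conv_rhs => rw [← degDiv_euler one_pos (U j)]
    congr 1
    -- By closedness, the j-th derivative of Σ x_i U_i is U_j + Σ x_i ∂_i U_j, that is, 1 plus the
    -- Euler operator applied to U_j.
    rw [map_sum]
    simp only [Derivation.leibniz, smul_eq_mul, Finset.sum_add_distrib, pderiv_X, Nat.cast_one,
      one_smul]
    rw [add_comm]
    congr 1
    · simp [Pi.single_apply]
    · exact Finset.sum_congr rfl fun i _ => by rw [hc]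

/-- The divergence of xB is d plus the Euler operator applied to B, which `degDiv d d` inverts
without raising the degree. -/
lemma exists_radial_div_eq (hd : 0 < d) {ψ : MvPolynomial (Fin d) ℝ} (hψ : ψ ∈ polyLE d k) :
    ∃ B ∈ polyLE d k, ∑ i, pderiv i (X i * B) = ψ := by
  refine ⟨degDiv d d ψ, degDiv_mem_polyLE _ hψ, ?_⟩
  conv_rhs => rw [← euler_degDiv hd ψ]
  simp only [Derivation.leibniz, smul_eq_mul, Finset.sum_add_distrib, pderiv_X_self, mul_one]
  rw [add_comm]
  simp [smul_eq_C_mul]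

end Algebra

/-! ### The reference simplex and divisibility by barycentric coordinates. -/

section Barycentric

variable {n : ℕ} {k : ℤ}

/-- The barycentric coordinates on the reference simplex, as real numbers. -/
def baryVal {d : ℕ} (y : Fin d → ℝ) : Fin (d + 1) → ℝ := Fin.cons (1 - ∑ i, y i) y

/-- The barycentric coordinates on the reference simplex, as polynomials. -/
noncomputable def bary (d : ℕ) : Fin (d + 1) → MvPolynomial (Fin d) ℝ :=
  Fin.cons (1 - ∑ i, X i) X

/-- The closed reference simplex. -/
def refSimplex (d : ℕ) : Set (Fin d → ℝ) := {y | ∀ j, 0 ≤ baryVal y j}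

/-- The vertices of the reference simplex. -/
def refVertex {d : ℕ} (j : Fin (d + 1)) : Fin d → ℝ := fun i => if i.succ = j then 1 else 0

@[simp] lemma baryVal_zero {d : ℕ} (y : Fin d → ℝ) : baryVal y 0 = 1 - ∑ i, y i := rfl
@[simp] lemma baryVal_succ {d : ℕ} (y : Fin d → ℝ) (i : Fin d) : baryVal y i.succ = y i := rfl
@[simp] lemma bary_zero (d : ℕ) : bary d 0 = 1 - ∑ i, X i := rfl
@[simp] lemma bary_succ {d : ℕ} (i : Fin d) : bary d i.succ = X i := rfl

lemma sum_baryVal {d : ℕ} (y : Fin d → ℝ) : ∑ j, baryVal y j = 1 := by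
  simp [Fin.sum_univ_succ]

@[simp] lemma eval_bary {d : ℕ} (y : Fin d → ℝ) (j : Fin (d + 1)) :
    eval y (bary d j) = baryVal y j := by
  refine Fin.cases ?_ (fun i => ?_) j <;> simp

lemma baryVal_refVertex {d : ℕ} (j k : Fin (d + 1)) :
    baryVal (refVertex j : Fin d → ℝ) k = if k = j then 1 else 0 := by
  refine Fin.cases ?_ (fun i => ?_) k
  · refine Fin.cases ?_ (fun i => ?_) j
    · simp [refVertex, Fin.succ_ne_zero]
    · simp [refVertex, (Fin.succ_ne_zero _).symm]
  · simp [refVertex]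

lemma refVertex_mem {d : ℕ} (j : Fin (d + 1)) : (refVertex j : Fin d → ℝ) ∈ refSimplex d := by
  intro k; rw [baryVal_refVertex]; split_ifs <;> norm_num

lemma bary_mem_polyLE {d : ℕ} (j : Fin (d + 1)) : bary d j ∈ polyLE d 1 := by
  refine Fin.cases ?_ (fun i => ?_) j
  · exact Submodule.sub_mem _ (by simpa using C_mem_polyLE (d := d) 1 zero_le_one)
      (Submodule.sum_mem _ fun i _ => X_mem_polyLE i le_rfl)
  · exact X_mem_polyLE i le_rfl

/-- A small open cube in the reference simplex. -/
def refCube (d : ℕ) : Set (Fin d → ℝ) := Set.pi Set.univ fun _ => Set.Ioo 0 (1 / ((d : ℝ) + 1))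

lemma isOpen_refCube (d : ℕ) : IsOpen (refCube d) :=
  isOpen_set_pi Set.finite_univ fun _ _ => isOpen_Ioo

lemma sum_lt_of_mem_refCube {d : ℕ} {y : Fin d → ℝ} (hy : y ∈ refCube d) (s : Finset (Fin d)) :
    ∑ i ∈ s, y i ≤ 1 := by
  have h : ∀ i, y i ∈ Set.Ioo (0 : ℝ) (1 / ((d : ℝ) + 1)) := fun i => hy i trivial
  calc ∑ i ∈ s, y i ≤ ∑ i, y i :=
        Finset.sum_le_sum_of_subset_of_nonneg (Finset.subset_univ s) fun i _ _ => (h i).1.le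
    _ ≤ ∑ _i : Fin d, 1 / ((d : ℝ) + 1) := Finset.sum_le_sum fun i _ => (h i).2.le
    _ ≤ 1 := by
      simp only [Finset.sum_const, Finset.card_univ, Fintype.card_fin, nsmul_eq_mul, mul_one_div]
      rw [div_le_one (by positivity)]; linarith

lemma refCube_subset (d : ℕ) : refCube d ⊆ refSimplex d := by
  intro y hy j
  refine Fin.cases ?_ (fun i => (hy i trivial).1.le) j
  simpa using sum_lt_of_mem_refCube hy Finset.univ

lemma eq_zero_of_refCube {d : ℕ} {q : MvPolynomial (Fin d) ℝ}
    (h : ∀ y ∈ refCube d, eval y q = 0) : q = 0 :=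
  funext_set (fun _ => Set.Ioo (0 : ℝ) (1 / ((d : ℝ) + 1)))
    (fun _ => Set.Ioo_infinite (by positivity)) fun y hy => by simpa using h y hy

lemma eq_zero_of_refSimplex {d : ℕ} {q : MvPolynomial (Fin d) ℝ}
    (h : ∀ y ∈ refSimplex d, eval y q = 0) : q = 0 :=
  eq_zero_of_refCube fun y hy => h y (refCube_subset d hy)

/-- An affine substitution projecting onto the hyperplane `bary j = 0`. -/
noncomputable def facetSubst (j : Fin (n + 2)) :
    MvPolynomial (Fin (n + 1)) ℝ →ₐ[ℝ] MvPolynomial (Fin (n + 1)) ℝ :=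
  aeval fun i => Fin.cases (motive := fun _ => MvPolynomial (Fin (n + 1)) ℝ)
    -- For the facet opposite to the origin, the deficit 1 - Σ y_i is added to the first coordinate,
    -- so that the coordinates sum to one.
    (X i + if i = 0 then bary (n + 1) 0 else 0) (fun j => if i = j then 0 else X i) j

/-- The substitution fixes each variable modulo `bary j`, and it is a ring homomorphism, so it fixes
every polynomial modulo `bary j`. -/
lemma bary_dvd_sub_facetSubst (j : Fin (n + 2)) (q : MvPolynomial (Fin (n + 1)) ℝ) :
    bary (n + 1) j ∣ q - facetSubst j q := by
  induction q using MvPolynomial.induction_on with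
  | C a => simp [facetSubst, MvPolynomial.algebraMap_eq]
  | add p q hp hq =>
    rw [map_add, add_sub_add_comm]; exact dvd_add hp hq
  | mul_X p i hp =>
    have h : bary (n + 1) j ∣ X i - facetSubst j (X i) := by
      refine Fin.cases ?_ (fun j => ?_) j
      · simp only [facetSubst, aeval_X, Fin.cases_zero]
        split_ifs
        · exact ⟨-1, by ring⟩
        · simp
      · simp only [facetSubst, aeval_X, Fin.cases_succ, bary_succ]
        split_ifs with h <;> simp [h]
    have : p * X i - facetSubst j (p * X i) =
        (p - facetSubst j p) * X i + facetSubst j p * (X i - facetSubst j (X i)) := by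
      rw [map_mul]; ring
    rw [this]
    exact dvd_add (dvd_mul_of_dvd_left hp _) (dvd_mul_of_dvd_right h _)

lemma eval_aeval {d d' : ℕ} (f : Fin d → MvPolynomial (Fin d') ℝ) (y : Fin d' → ℝ)
    (q : MvPolynomial (Fin d) ℝ) : eval y (aeval f q) = eval (fun i => eval y (f i)) q := by
  have : (aeval y).comp (aeval f) = (aeval fun i => eval y (f i) : _ →ₐ[ℝ] ℝ) := by
    ext i; simp [MvPolynomial.aeval_eq_eval]
  have := DFunLike.congr_fun this q
  simpa [MvPolynomial.aeval_eq_eval] using this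

lemma eval_facetSubst_zero (y : Fin (n + 1) → ℝ) (i : Fin (n + 1)) :
    eval y (facetSubst 0 (X i)) = y i + if i = 0 then baryVal y 0 else 0 := by
  simp only [facetSubst, aeval_X, Fin.cases_zero, map_add, eval_X]
  split_ifs <;> simp

lemma eval_facetSubst_succ (y : Fin (n + 1) → ℝ) (j i : Fin (n + 1)) :
    eval y (facetSubst j.succ (X i)) = if i = j then 0 else y i := by
  simp only [facetSubst, aeval_X, Fin.cases_succ]
  split_ifs <;> simp

/-- The substitution maps an open cube of the simplex into the facet, so the substituted polynomial
vanishes on that cube. -/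
lemma facetSubst_eq_zero {j : Fin (n + 2)} {q : MvPolynomial (Fin (n + 1)) ℝ}
    (h : ∀ y ∈ refSimplex (n + 1), baryVal y j = 0 → eval y q = 0) : facetSubst j q = 0 := by
  refine eq_zero_of_refCube fun y hy => ?_
  have e : eval y (facetSubst j q) = eval (fun i => eval y (facetSubst j (X i))) q := by
    simp only [facetSubst, eval_aeval, aeval_X]
  rw [e]
  have hb : ∀ i, 0 ≤ y i := fun i => (hy i trivial).1.le
  have hs := sum_lt_of_mem_refCube hy
  refine h _ ?_ ?_ <;> clear e h
  · cases j using Fin.cases with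
    | zero =>
      intro i
      cases i using Fin.cases with
      | zero => simp [eval_facetSubst_zero, Finset.sum_add_distrib]
      | succ i =>
        rw [baryVal_succ, eval_facetSubst_zero]
        split_ifs
        · exact add_nonneg (hb i) (by simpa using hs Finset.univ)
        · simpa using hb i
    | succ j =>
      intro i
      cases i using Fin.cases with
      | zero =>
        rw [baryVal_zero, sub_nonneg]
        refine le_trans (le_of_eq ?_) (hs (Finset.univ.erase j))
        rw [← Finset.sum_erase_add _ _ (Finset.mem_univ j)]
        simp only [eval_facetSubst_succ, if_true, add_zero]
        exact Finset.sum_congr rfl fun i hi => if_neg (Finset.ne_of_mem_erase hi)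
      | succ i =>
        rw [baryVal_succ, eval_facetSubst_succ]
        split_ifs
        exacts [le_rfl, hb i]
  · cases j using Fin.cases with
    | zero => simp [eval_facetSubst_zero, Finset.sum_add_distrib]
    | succ j => simp [eval_facetSubst_succ]

lemma bary_ne_zero {d : ℕ} (j : Fin (d + 1)) : bary d j ≠ 0 := fun h => by
  have := eval_bary (refVertex j : Fin d → ℝ) j
  rw [h, baryVal_refVertex] at this
  simp at this

lemma facetSubst_bary_ne_zero {j k : Fin (n + 2)} (h : j ≠ k) :
    facetSubst j (bary (n + 1) k) ≠ 0 := fun h0 => by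
  obtain ⟨r, hr⟩ := bary_dvd_sub_facetSubst j (bary (n + 1) k)
  have := congrArg (eval (refVertex k : Fin (n + 1) → ℝ)) hr
  rw [h0, sub_zero, map_mul, eval_bary, eval_bary, baryVal_refVertex, baryVal_refVertex,
    if_neg h] at this
  simp at this

/-- A polynomial vanishing on some facets of the reference simplex is divisible by the product of
the corresponding barycentric coordinates. -/
lemma prod_bary_dvd {q : MvPolynomial (Fin (n + 1)) ℝ} (S : Finset (Fin (n + 2)))
    (h : ∀ j ∈ S, ∀ y ∈ refSimplex (n + 1), baryVal y j = 0 → eval y q = 0) :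
    ∏ j ∈ S, bary (n + 1) j ∣ q := by
  classical
  induction S using Finset.induction_on with
  | empty => simp
  | insert j S hj ih =>
    obtain ⟨r, rfl⟩ := ih fun k hk => h k (Finset.mem_insert_of_mem hk)
    have h0 := facetSubst_eq_zero (h j (Finset.mem_insert_self j S))
    rw [map_mul, map_prod] at h0
    -- The other barycentric coordinates do not vanish identically on facet j, so in the integral
    -- domain of polynomials the cofactor `r` must do so.
    have h1 : facetSubst j r = 0 := (mul_eq_zero.1 h0).resolve_left
      (Finset.prod_ne_zero_iff.2 fun k hk =>
        facetSubst_bary_ne_zero fun e => hj (by rwa [e]))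
    obtain ⟨w, hw⟩ := bary_dvd_sub_facetSubst j r
    rw [h1, sub_zero] at hw
    rw [Finset.prod_insert hj, hw]
    exact ⟨w, by ring⟩

lemma bary_dvd {q : MvPolynomial (Fin (n + 1)) ℝ} {j : Fin (n + 2)}
    (h : ∀ y ∈ refSimplex (n + 1), baryVal y j = 0 → eval y q = 0) : bary (n + 1) j ∣ q := by
  simpa using prod_bary_dvd {j} (by simpa using h)

lemma one_le_totalDegree_bary (j : Fin (n + 2)) : 1 ≤ (bary (n + 1) j).totalDegree := by
  by_contra! h
  obtain ⟨k, hk⟩ := exists_ne j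
  have e := totalDegree_eq_zero_iff_eq_C.1 (Nat.lt_one_iff.1 h)
  have h1 := eval_bary (refVertex j : Fin (n + 1) → ℝ) j
  have h2 := eval_bary (refVertex k : Fin (n + 1) → ℝ) j
  rw [e, eval_C, baryVal_refVertex] at h1 h2
  rw [if_pos rfl] at h1
  rw [if_neg hk.symm, h1] at h2
  exact one_ne_zero h2

/-- Total degrees add over a domain, and `bary j` is not constant. -/
lemma mem_polyLE_of_bary_mul {j : Fin (n + 2)} {q : MvPolynomial (Fin (n + 1)) ℝ}
    (h : bary (n + 1) j * q ∈ polyLE (n + 1) k) : q ∈ polyLE (n + 1) (k - 1) := by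
  by_cases hq : q = 0
  · rw [hq]; exact Submodule.zero_mem _
  have h1 := one_le_totalDegree_bary j
  rw [mem_polyLE_iff (mul_ne_zero (bary_ne_zero j) hq),
    totalDegree_mul_of_isDomain (bary_ne_zero j) hq] at h
  rw [mem_polyLE_iff hq]
  push_cast at h
  omega

lemma mem_polyLE_of_prod_bary_mul (S : Finset (Fin (n + 2))) {q : MvPolynomial (Fin (n + 1)) ℝ}
    (h : (∏ j ∈ S, bary (n + 1) j) * q ∈ polyLE (n + 1) k) :
    q ∈ polyLE (n + 1) (k - S.card) := by
  classical
  induction S using Finset.induction_on generalizing k with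
  | empty => simpa using h
  | insert j S hj ih =>
    rw [Finset.prod_insert hj, mul_assoc] at h
    refine polyLE_mono (le_of_eq ?_) (ih (mem_polyLE_of_bary_mul h))
    rw [Finset.card_insert_of_notMem hj]; push_cast; ring

end Barycentric

/-! ### Integration over the reference simplex and the divergence theorem. -/

section Integral

variable {d n : ℕ}

lemma continuous_eval_poly (q : MvPolynomial (Fin d) ℝ) : Continuous fun y => eval y q := by
  simpa using MvPolynomial.continuous_eval q

lemma hasDerivAt_eval {γ : ℝ → Fin d → ℝ} {v : Fin d → ℝ} {s : ℝ}
    (hγ : ∀ i, HasDerivAt (fun t => γ t i) (v i) s) (q : MvPolynomial (Fin d) ℝ) :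
    HasDerivAt (fun t => eval (γ t) q) (∑ i, v i * eval (γ s) (pderiv i q)) s := by
  induction q using MvPolynomial.induction_on with
  | C a => simpa using hasDerivAt_const s a
  | add p q hp hq =>
    simp only [map_add, mul_add, Finset.sum_add_distrib]
    exact hp.add hq
  | mul_X p i hp =>
    simp only [map_mul, eval_X]
    refine (hp.mul (hγ i)).congr_deriv ?_
    symm
    simp only [Derivation.leibniz, smul_eq_mul, map_add, map_mul, eval_X, mul_add,
      Finset.sum_add_distrib, pderiv_X, Pi.single_apply, apply_ite (eval (γ s)), map_zero,
      mul_ite, mul_one, mul_zero, Finset.sum_mul]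
    rw [add_comm]
    simp only [Finset.sum_ite_eq, Finset.mem_univ, if_true]
    congr 1
    · exact Finset.sum_congr rfl fun j _ => by ring
    · ring

lemma continuous_baryVal (j : Fin (d + 1)) : Continuous fun y : Fin d → ℝ => baryVal y j := by
  simpa using continuous_eval_poly (bary d j)

lemma isClosed_refSimplex (d : ℕ) : IsClosed (refSimplex d) := by
  have : refSimplex d = ⋂ j, {y | 0 ≤ baryVal y j} := by ext; simp [refSimplex]
  rw [this]
  exact isClosed_iInter fun j => isClosed_le continuous_const (continuous_baryVal j)

lemma isCompact_refSimplex (d : ℕ) : IsCompact (refSimplex d) := by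
  refine (isCompact_Icc (a := (0 : Fin d → ℝ)) (b := 1)).of_isClosed_subset
    (isClosed_refSimplex d) fun y hy => ⟨fun i => hy i.succ, fun i => ?_⟩
  have h0 : 0 ≤ 1 - ∑ i, y i := hy 0
  have := Finset.single_le_sum (f := y) (fun j _ => hy j.succ) (Finset.mem_univ i)
  simp only [Pi.one_apply]; linarith

lemma measurableSet_refSimplex (d : ℕ) : MeasurableSet (refSimplex d) :=
  (isClosed_refSimplex d).measurableSet

lemma integrableOn_eval (q : MvPolynomial (Fin d) ℝ) :
    IntegrableOn (fun y => eval y q) (refSimplex d) :=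
  (continuous_eval_poly q).continuousOn.integrableOn_compact (isCompact_refSimplex d)

/-- Integration of polynomials over the reference simplex. -/
noncomputable def refInt (d : ℕ) : MvPolynomial (Fin d) ℝ →ₗ[ℝ] ℝ where
  toFun q := ∫ y in refSimplex d, eval y q
  map_add' p q := by
    simp only [map_add]; exact integral_add (integrableOn_eval p) (integrableOn_eval q)
  map_smul' c q := by
    simp only [smul_eval, RingHom.id_apply, smul_eq_mul]; exact integral_const_mul c _

lemma refInt_apply (q : MvPolynomial (Fin d) ℝ) :
    refInt d q = ∫ y in refSimplex d, eval y q := rfl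

lemma refInt_nonneg {q : MvPolynomial (Fin d) ℝ} (h : ∀ y ∈ refSimplex d, 0 ≤ eval y q) :
    0 ≤ refInt d q :=
  setIntegral_nonneg (measurableSet_refSimplex d) h

/-- A nonnegative function with zero integral vanishes almost everywhere; by continuity the
polynomial vanishes on an open cube, hence identically. -/
lemma eq_zero_of_refInt_eq_zero {q : MvPolynomial (Fin d) ℝ}
    (h : ∀ y ∈ refSimplex d, 0 ≤ eval y q) (h0 : refInt d q = 0) : q = 0 := by
  have h1 := (setIntegral_eq_zero_iff_of_nonneg_ae
    (ae_restrict_of_forall_mem (measurableSet_refSimplex d) h) (integrableOn_eval q)).1 h0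
  have h2 : (fun y => eval y q) =ᵐ[volume.restrict (refCube d)] fun _ => 0 :=
    ae_restrict_of_ae_restrict_of_subset (refCube_subset d) h1
  exact eq_zero_of_refCube fun y hy => Measure.eqOn_open_of_ae_eq h2 (isOpen_refCube d)
    (continuous_eval_poly q).continuousOn continuousOn_const hy

lemma eval_prod_bary_mul_sq_nonneg (S : Finset (Fin (d + 1))) (h : MvPolynomial (Fin d) ℝ)
    {y : Fin d → ℝ} (hy : y ∈ refSimplex d) : 0 ≤ eval y ((∏ j ∈ S, bary d j) * h ^ 2) := by
  rw [map_mul, map_pow, map_prod]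
  refine mul_nonneg (Finset.prod_nonneg fun j _ => ?_) (sq_nonneg _)
  rw [eval_bary]; exact hy j

lemma eq_zero_of_refInt_prod_bary_mul_sq {S : Finset (Fin (d + 1))} {h : MvPolynomial (Fin d) ℝ}
    (h0 : refInt d ((∏ j ∈ S, bary d j) * h ^ 2) = 0) : h = 0 := by
  have := eq_zero_of_refInt_eq_zero (fun y hy => eval_prod_bary_mul_sq_nonneg S h hy) h0
  simpa [Finset.prod_eq_zero_iff, bary_ne_zero] using this

lemma insertNth_mem_refSimplex (i : Fin (n + 1)) (s : ℝ) (y : Fin n → ℝ) :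
    i.insertNth s y ∈ refSimplex (n + 1) ↔ (∀ k, 0 ≤ y k) ∧ s ∈ Set.Icc 0 (1 - ∑ k, y k) := by
  simp only [refSimplex, Set.mem_ofPred_eq, Fin.forall_fin_succ (n := n + 1), baryVal_zero,
    baryVal_succ, Set.mem_Icc]
  rw [Fin.sum_univ_succAbove _ i, Fin.forall_iff_succAbove i]
  simp only [Fin.insertNth_apply_same, Fin.insertNth_apply_succAbove]
  constructor
  · rintro ⟨h1, h2, h3⟩; exact ⟨h3, h2, by linarith⟩
  · rintro ⟨h1, h2, h3⟩; exact ⟨by linarith, h2, h1⟩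

/-- A line in direction i either misses the simplex or meets it in a segment from y_i = 0 to λ₀ = 0;
there the fundamental theorem of calculus applies. -/
lemma integral_pderiv_line_eq_zero (i : Fin (n + 1)) {q : MvPolynomial (Fin (n + 1)) ℝ}
    (h0 : ∀ y : Fin (n + 1) → ℝ, y i = 0 → eval y q = 0)
    (h1 : ∀ y : Fin (n + 1) → ℝ, baryVal y 0 = 0 → eval y q = 0) (y : Fin n → ℝ) :
    ∫ s, (refSimplex (n + 1)).indicator (fun y => eval y (pderiv i q)) (i.insertNth s y) = 0 := by
  by_cases hy : (∀ k, 0 ≤ y k) ∧ 0 ≤ 1 - ∑ k, y k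
  · have e : (fun s => (refSimplex (n + 1)).indicator (fun y => eval y (pderiv i q))
        (i.insertNth s y)) = (Set.Icc 0 (1 - ∑ k, y k)).indicator
          fun s => eval (i.insertNth s y : Fin (n + 1) → ℝ) (pderiv i q) := by
      ext s
      simp only [Set.indicator, insertNth_mem_refSimplex, hy.1, implies_true, true_and]
    have hc : Continuous fun s : ℝ => (i.insertNth s y : Fin (n + 1) → ℝ) := by fun_prop
    rw [e, integral_indicator measurableSet_Icc, integral_Icc_eq_integral_Ioc,
      ← intervalIntegral.integral_of_le hy.2,
      intervalIntegral.integral_eq_sub_of_hasDerivAt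
        (f := fun s => eval (i.insertNth s y : Fin (n + 1) → ℝ) q)]
    · rw [h1, h0, sub_zero]
      · simp
      · rw [baryVal_zero, Fin.sum_univ_succAbove _ i]; simp
    · intro s _
      refine (hasDerivAt_eval (γ := fun s => (i.insertNth s y : Fin (n + 1) → ℝ))
        (v := Pi.single i 1) (s := s) (fun k => ?_) q).congr_deriv ?_
      · cases k using i.succAboveCases with
        | x => simpa using hasDerivAt_id' s
        | p k => simpa using hasDerivAt_const s (y k)
      · simp [Pi.single_apply]
    · exact ((continuous_eval_poly _).comp hc).intervalIntegrable _ _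
  · have e : ∀ s, (refSimplex (n + 1)).indicator (fun y => eval y (pderiv i q))
        (i.insertNth s y) = 0 := by
      intro s
      refine Set.indicator_of_notMem (fun h => hy ?_) _
      rw [insertNth_mem_refSimplex] at h
      exact ⟨h.1, h.2.1.trans h.2.2⟩
    simp [e]

lemma refInt_pderiv_eq_zero (i : Fin (n + 1)) {q : MvPolynomial (Fin (n + 1)) ℝ}
    (h0 : ∀ y : Fin (n + 1) → ℝ, y i = 0 → eval y q = 0)
    (h1 : ∀ y : Fin (n + 1) → ℝ, baryVal y 0 = 0 → eval y q = 0) :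
    refInt (n + 1) (pderiv i q) = 0 := by
  have hint := (integrable_indicator_iff (measurableSet_refSimplex (n + 1))).2
    (integrableOn_eval (pderiv i q))
  have mp := (volume_preserving_piFinSuccAbove (fun _ : Fin (n + 1) => ℝ) i).symm
  rw [refInt_apply, ← integral_indicator (measurableSet_refSimplex _),
    ← mp.integral_comp (MeasurableEquiv.measurableEmbedding _)]
  have hint' := (mp.integrable_comp_emb (MeasurableEquiv.measurableEmbedding _)).2 hint
  rw [Measure.volume_eq_prod, integral_prod_symm _ (by exact hint')]
  refine integral_eq_zero_of_ae (Filter.Eventually.of_forall fun y => ?_)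
  exact integral_pderiv_line_eq_zero i h0 h1 y

lemma pderiv_bary_zero (i : Fin d) : pderiv i (bary d 0) = -1 := by
  simp [pderiv_X, Pi.single_apply]

lemma X_mul_pderiv_monomial_self (i : Fin d) (m : Fin d →₀ ℕ) (a : ℝ) :
    X i * pderiv i (monomial m a) = (m i : ℝ) • monomial m a := by
  have := X_mul_pderiv_monomial (R := ℝ) (σ := Fin d) (i := i) (m := m) (r := a)
  rw [this, ← Nat.cast_smul_eq_nsmul ℝ]

/-- For a monomial M, the derivative ∂_i(x_i λ₀ M) = (m_i + 1) λ₀ M - x_i M integrates to zero,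
since x_i λ₀ M vanishes at both ends of every line in direction i. -/
lemma refInt_X_mul_monomial (i : Fin (n + 1)) (m : Fin (n + 1) →₀ ℕ) (a : ℝ) :
    refInt (n + 1) (X i * monomial m a) =
      ((m i : ℝ) + 1) * refInt (n + 1) (bary (n + 1) 0 * monomial m a) := by
  have h := refInt_pderiv_eq_zero i (q := X i * bary (n + 1) 0 * monomial m a)
    (fun y hy => by simp [hy]) (fun y hy => by simp only [map_mul, eval_bary, hy]; simp)
  have e : pderiv i (X i * bary (n + 1) 0 * monomial m a) =
      ((m i : ℝ) + 1) • (bary (n + 1) 0 * monomial m a) - X i * monomial m a := by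
    have e1 := X_mul_pderiv_monomial_self i m a
    simp only [Derivation.leibniz, smul_eq_mul, pderiv_bary_zero, pderiv_X_self]
    rw [add_smul, one_smul, ← mul_smul_comm, ← e1]
    ring
  rw [e, map_sub, map_smul, smul_eq_mul, sub_eq_zero] at h
  exact h.symm

/-- Multiply by λ₀ + Σ x_i = 1 and use the preceding lemma; the factor is 1 + Σ (m_i + 1) over n + 1
indices. -/
lemma refInt_monomial (m : Fin (n + 1) →₀ ℕ) (a : ℝ) :
    refInt (n + 1) (monomial m a) =
      ((m.degree : ℝ) + n + 2) * refInt (n + 1) (bary (n + 1) 0 * monomial m a) := by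
  have e : monomial m a = bary (n + 1) 0 * monomial m a + ∑ i, X i * monomial m a := by
    rw [bary_zero, sub_mul, Finset.sum_mul]; ring
  have hd : ∑ i, (m i : ℝ) = m.degree := by
    rw [Finsupp.degree_eq_sum]; push_cast; rfl
  conv_lhs => rw [e]
  rw [map_add, map_sum]
  simp only [refInt_X_mul_monomial]
  rw [← Finset.sum_mul, Finset.sum_add_distrib, hd]
  simp only [Finset.sum_const, Finset.card_univ, Fintype.card_fin, nsmul_eq_mul, mul_one]
  push_cast
  ring

/-- The functional integrating over the facet opposite to the origin, for the normalization that
makes it the boundary term of the divergence theorem. -/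
noncomputable def facetInt (d : ℕ) : MvPolynomial (Fin d) ℝ →ₗ[ℝ] ℝ :=
  -- The integrand is the divergence of q x. The field x is tangent to the facets through the
  -- origin, so only the opposite facet carries flux.
  (refInt d).comp ((d : ℝ) • LinearMap.id +
    ∑ i, (LinearMap.mulLeft ℝ (X i)).comp (pderiv i : Derivation ℝ _ _).toLinearMap)

lemma facetInt_monomial (m : Fin d →₀ ℕ) (a : ℝ) :
    facetInt d (monomial m a) = ((m.degree : ℝ) + d) * refInt d (monomial m a) := by
  have h : facetInt d (monomial m a) =
      refInt d ((d : ℝ) • monomial m a + ∑ i, X i * pderiv i (monomial m a)) := by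
    simp [facetInt, LinearMap.sum_apply]
  rw [h, sum_X_mul_pderiv_monomial, ← smul_eq_mul ((m.degree : ℝ)), ← smul_monomial,
    ← add_smul, map_smul, smul_eq_mul, add_comm]

/-- A field in direction i with factor x_i has no flux through the coordinate facets, so the
integral of its divergence is the boundary term on λ₀ = 0. -/
lemma facetInt_X_mul (i : Fin (n + 1)) (q : MvPolynomial (Fin (n + 1)) ℝ) :
    facetInt (n + 1) (X i * q) = refInt (n + 1) (pderiv i (X i * q)) := by
  induction q using MvPolynomial.induction_on' with
  | monomial m a =>
    have e1 : pderiv i (X i * monomial m a) = ((m i : ℝ) + 1) • monomial m a := by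
      rw [Derivation.leibniz, smul_eq_mul, X_mul_pderiv_monomial_self, pderiv_X_self, smul_eq_mul,
        mul_one, add_smul, one_smul]
    have e2 : X i * monomial m a = monomial (Finsupp.single i 1 + m) a := by
      rw [X, monomial_mul, one_mul]
    rw [e1, map_smul, e2, facetInt_monomial, ← e2, refInt_X_mul_monomial, refInt_monomial,
      smul_eq_mul, map_add, Finsupp.degree_single]
    push_cast
    ring
  | add p q hp hq => simp only [mul_add, map_add, hp, hq]

/-- This expresses that `facetInt` only sees the values on the facet λ₀ = 0. -/
lemma facetInt_bary_zero_mul (q : MvPolynomial (Fin (n + 1)) ℝ) :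
    facetInt (n + 1) (bary (n + 1) 0 * q) = 0 := by
  induction q using MvPolynomial.induction_on' with
  | monomial m a =>
    have hd : ∑ i, (m i : ℝ) = m.degree := by
      rw [Finsupp.degree_eq_sum]; push_cast; rfl
    have e1 : ∀ i, pderiv i (X i * monomial m a) = ((m i : ℝ) + 1) • monomial m a := fun i => by
      rw [Derivation.leibniz, smul_eq_mul, X_mul_pderiv_monomial_self, pderiv_X_self, smul_eq_mul,
        mul_one, add_smul, one_smul]
    rw [bary_zero, sub_mul, Finset.sum_mul, map_sub, map_sum, one_mul, facetInt_monomial]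
    simp only [facetInt_X_mul, e1, map_smul, smul_eq_mul]
    rw [← Finset.sum_mul, Finset.sum_add_distrib, hd]
    simp
  | add p q hp hq => simp only [mul_add, map_add, hp, hq, add_zero]

/-- The divergence theorem on the reference simplex for polynomial fields with vanishing normal
component on the boundary. -/
lemma refInt_div_eq_zero {F : Fin (n + 1) → MvPolynomial (Fin (n + 1)) ℝ}
    (h : ∀ i, X i ∣ F i) (h0 : bary (n + 1) 0 ∣ ∑ i, F i) :
    refInt (n + 1) (∑ i, pderiv i (F i)) = 0 := by
  have : ∀ i, refInt (n + 1) (pderiv i (F i)) = facetInt (n + 1) (F i) := fun i => by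
    obtain ⟨G, hG⟩ := h i
    rw [hG, facetInt_X_mul]
  obtain ⟨H, hH⟩ := h0
  rw [map_sum, Finset.sum_congr rfl fun i _ => this i, ← map_sum, hH, facetInt_bary_zero_mul]

end Integral

/-! ### Unisolvence on the reference segment, triangle and tetrahedron. -/

section Reference

variable {d n : ℕ} {k : ℤ}

/-- The linear parts of the barycentric coordinates. -/
def baryLin {d : ℕ} (v : Fin d → ℝ) : Fin (d + 1) → ℝ := Fin.cons (-∑ i, v i) v

@[simp] lemma baryLin_zero (v : Fin d → ℝ) : baryLin v 0 = -∑ i, v i := rfl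
@[simp] lemma baryLin_succ (v : Fin d → ℝ) (i : Fin d) : baryLin v i.succ = v i := rfl

lemma sum_baryLin (v : Fin d → ℝ) : ∑ j, baryLin v j = 0 := by
  simp [Fin.sum_univ_succ]

lemma baryVal_sub (y z : Fin d → ℝ) (j : Fin (d + 1)) :
    baryLin (z - y) j = baryVal z j - baryVal y j := by
  refine Fin.cases ?_ (fun i => ?_) j <;> simp

lemma baryVal_add_smul (y v : Fin d → ℝ) (s : ℝ) (j : Fin (d + 1)) :
    baryVal (y + s • v) j = baryVal y j + s * baryLin v j := by
  refine Fin.cases ?_ (fun i => ?_) j <;> simp [Finset.sum_add_distrib, Finset.mul_sum]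
  ring

/-- The tangential components of the covector field `U` vanish on the facets of the reference
simplex. -/
def TraceZero (U : Fin d → MvPolynomial (Fin d) ℝ) : Prop :=
  ∀ j, ∀ y ∈ refSimplex d, baryVal y j = 0 → ∀ v : Fin d → ℝ, baryLin v j = 0 →
    ∑ i, v i * eval y (U i) = 0

/-- Along a segment inside a facet, the derivative of φ is a tangential component of U, hence zero;
the mean value theorem concludes. -/
lemma eval_eq_of_facet {U : Fin d → MvPolynomial (Fin d) ℝ} (hU : TraceZero U)
    {φ : MvPolynomial (Fin d) ℝ} (hφ : ∀ i, pderiv i φ = U i) {j : Fin (d + 1)}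
    {y z : Fin d → ℝ} (hy : y ∈ refSimplex d) (hz : z ∈ refSimplex d) (hyj : baryVal y j = 0)
    (hzj : baryVal z j = 0) : eval z φ = eval y φ := by
  have hder : ∀ s, HasDerivAt (fun s : ℝ => eval (y + s • (z - y)) φ)
      (∑ i, (z - y) i * eval (y + s • (z - y)) (U i)) s := fun s => by
    simp only [← hφ]
    refine hasDerivAt_eval (fun i => ?_) φ
    simpa using ((hasDerivAt_id' s).mul_const (z i - y i)).const_add (y i)
  obtain ⟨c, ⟨hc0, hc1⟩, hc⟩ := exists_hasDerivAt_eq_slope _ _ (zero_lt_one' ℝ)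
    (fun s _ => (hder s).continuousAt.continuousWithinAt) fun s _ => hder s
  have hl : baryLin (z - y) j = 0 := by rw [baryVal_sub, hyj, hzj, sub_zero]
  have hm : y + c • (z - y) ∈ refSimplex d := fun i => by
    rw [baryVal_add_smul, baryVal_sub]
    nlinarith [hy i, hz i]
  rw [hU j _ hm (by rw [baryVal_add_smul, hyj, hl]; simp) _ hl] at hc
  simp only [one_smul, add_sub_cancel, zero_smul, add_zero, sub_zero, div_one] at hc
  linarith

/-- In dimension at least two, any vertex shares a facet with vertex 0, so the constant values of φ
on the facets all agree with its value there. For a segment this fails. -/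
lemma vanishes_on_facets {U : Fin (n + 2) → MvPolynomial (Fin (n + 2)) ℝ} (hU : TraceZero U)
    {φ : MvPolynomial (Fin (n + 2)) ℝ} (hφ : ∀ i, pderiv i φ = U i)
    (h0 : eval (refVertex 0 : Fin (n + 2) → ℝ) φ = 0) (j : Fin (n + 3)) {y : Fin (n + 2) → ℝ}
    (hy : y ∈ refSimplex (n + 2)) (hj : baryVal y j = 0) : eval y φ = 0 := by
  have hv : ∀ {a b : Fin (n + 3)}, b ≠ a → baryVal (refVertex a : Fin (n + 2) → ℝ) b = 0 :=
    fun h => by rw [baryVal_refVertex, if_neg h]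
  obtain ⟨a, ha⟩ := exists_ne j
  obtain ⟨c, hc⟩ : ∃ c : Fin (n + 3), c ∉ ({a, 0} : Finset (Fin (n + 3))) := by
    by_contra! h
    have := Finset.card_le_card fun x (_ : x ∈ Finset.univ) => h x
    have := this.trans Finset.card_le_two
    simp at this
  simp only [Finset.mem_insert, Finset.mem_singleton, not_or] at hc
  rw [eval_eq_of_facet hU hφ (refVertex_mem a) hy (hv ha.symm) hj,
    eval_eq_of_facet hU hφ (refVertex_mem 0) (refVertex_mem a) (hv hc.2) (hv hc.1), h0]

/-- A closed field with vanishing tangential traces is determined by its moments against radial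
fields. -/
lemma eq_zero_of_closed {U : Fin (n + 2) → MvPolynomial (Fin (n + 2)) ℝ} (hk : 0 ≤ k)
    (hU : ∀ i, U i ∈ polyLE (n + 2) k) (hc : ∀ i j, pderiv i (U j) = pderiv j (U i))
    (ht : TraceZero U)
    (horth : ∀ B ∈ polyLE (n + 2) (k - (n + 2)), refInt (n + 2) (∑ i, U i * (X i * B)) = 0) :
    U = 0 := by
  obtain ⟨φ₀, hφ₀, hd₀⟩ := exists_potential hU hc
  set φ := φ₀ - C (eval (refVertex 0 : Fin (n + 2) → ℝ) φ₀) with hφdef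
  have hφ : φ ∈ polyLE (n + 2) (k + 1) :=
    Submodule.sub_mem _ hφ₀ (C_mem_polyLE _ (by omega))
  have hd : ∀ i, pderiv i φ = U i := fun i => by simp [hφdef, hd₀]
  obtain ⟨ψ, hψ⟩ := prod_bary_dvd (n := n + 1) (q := φ) Finset.univ fun j _ y hy hj =>
    vanishes_on_facets ht hd (by simp [hφdef]) j hy hj
  have hψm : ψ ∈ polyLE (n + 2) (k - (n + 2)) := by
    -- φ has degree k + 1 and the product has n + 3 factors, which leaves k - (n + 2).
    rw [hψ] at hφ
    refine polyLE_mono (le_of_eq ?_) (mem_polyLE_of_prod_bary_mul Finset.univ hφ)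
    simp; ring
  obtain ⟨B, hB, hdiv⟩ := exists_radial_div_eq (Nat.succ_pos (n + 1)) hψm
  have h0 : bary (n + 2) 0 ∣ φ := hψ ▸ dvd_mul_of_dvd_left
    (Finset.dvd_prod_of_mem _ (Finset.mem_univ 0)) ψ
  have h1 := refInt_div_eq_zero (F := fun i => φ * (X i * B))
    (fun i => ⟨φ * B, by ring⟩) (Finset.dvd_sum fun i _ => dvd_mul_of_dvd_left h0 _)
  have h2 : ∑ i, pderiv i (φ * (X i * B)) =
      -- The product rule with div(yB) = ψ and φ = (∏ λ_j) ψ; the last sum has zero integral by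
      -- `horth`.
      (∏ j, bary (n + 2) j) * ψ ^ 2 + ∑ i, U i * (X i * B) := by
    have : ∀ i, pderiv i (φ * (X i * B)) = φ * pderiv i (X i * B) + U i * (X i * B) := fun i => by
      rw [Derivation.leibniz, smul_eq_mul, smul_eq_mul, hd]; ring
    rw [Finset.sum_congr rfl fun i _ => this i, Finset.sum_add_distrib, ← Finset.mul_sum, hdiv]
    nth_rewrite 1 [hψ]
    ring
  rw [h2, map_add, horth B hB, add_zero] at h1
  have hψ0 := eq_zero_of_refInt_prod_bary_mul_sq h1
  ext1 i
  rw [← hd i, hψ, hψ0]; simp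

/-- Two-point values and moments determine a polynomial on the reference segment. -/
lemma eq_zero_of_segment {U : MvPolynomial (Fin 1) ℝ} (hU : U ∈ polyLE 1 k)
    (hv : ∀ j, eval (refVertex j : Fin 1 → ℝ) U = 0)
    (horth : ∀ q ∈ polyLE 1 (k - 2), refInt 1 (U * q) = 0) : U = 0 := by
  have hface : ∀ j : Fin 2, ∀ y ∈ refSimplex 1, baryVal y j = 0 → eval y U = 0 := by
    intro j y _ hy
    -- A facet of the segment is a single point, the other vertex.
    have : y = refVertex (1 - j) := by
      ext i
      fin_cases i
      fin_cases j
      · simp [refVertex] at hy ⊢; linarith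
      · have h1 : baryVal y 1 = y 0 := baryVal_succ y 0
        simp only [Fin.mk_one, h1] at hy
        simpa [refVertex] using hy
    rw [this]; exact hv _
  obtain ⟨h, hh⟩ := prod_bary_dvd (n := 0) (q := U) Finset.univ fun j _ => hface j
  have hm : h ∈ polyLE 1 (k - 2) := by
    rw [hh] at hU
    simpa using mem_polyLE_of_prod_bary_mul Finset.univ hU
  have h0 : refInt 1 ((∏ j, bary 1 j) * h ^ 2) = 0 := by
    rw [← horth h hm, hh]; congr 1; ring
  rw [hh, eq_zero_of_refInt_prod_bary_mul_sq h0, mul_zero]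

/-- The j-th basis vector is tangent to the facet x_i = 0. Likewise, in the next lemma, differences
of basis vectors are tangent to λ₀ = 0. -/
lemma TraceZero.X_dvd {U : Fin (n + 1) → MvPolynomial (Fin (n + 1)) ℝ} (hU : TraceZero U)
    {i j : Fin (n + 1)} (h : i ≠ j) : X i ∣ U j := by
  rw [← bary_succ]
  refine bary_dvd fun y hy hi => ?_
  have := hU i.succ y hy hi (Pi.single j 1) (by simp [h])
  simpa [Pi.single_apply] using this

lemma TraceZero.bary_zero_dvd {U : Fin (n + 1) → MvPolynomial (Fin (n + 1)) ℝ}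
    (hU : TraceZero U) (i j : Fin (n + 1)) : bary (n + 1) 0 ∣ U i - U j := by
  refine bary_dvd fun y hy hi => ?_
  have := hU 0 y hy hi (Pi.single i 1 - Pi.single j 1) (by simp [Pi.single_apply])
  simpa [Pi.single_apply, sub_mul, Finset.sum_sub_distrib] using this

/-- Unisolvence of the interior moments on the reference triangle. -/
lemma eq_zero_of_triangle {U : Fin 2 → MvPolynomial (Fin 2) ℝ} (hk : 0 ≤ k)
    (hU : ∀ i, U i ∈ polyLE 2 k) (ht : TraceZero U)
    (horth : ∀ A : Fin 2 → MvPolynomial (Fin 2) ℝ, (∀ i, A i ∈ polyLE 2 (k - 2)) →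
      ∀ B ∈ polyLE 2 (k - 2), refInt 2 (∑ i, U i * (A i + X i * B)) = 0) : U = 0 := by
  set ρ := pderiv 0 (U 1) - pderiv 1 (U 0) with hρ
  have hρm : ρ ∈ polyLE 2 (k - 1) :=
    Submodule.sub_mem _ (pderiv_mem_polyLE (hU 1) 0) (pderiv_mem_polyLE (hU 0) 1)
  have hk2 : k - 1 - 1 = k - 2 := by ring
  -- The test field is the rotated gradient of the curl ρ, of degree k - 2.
  have hA := horth ![-pderiv 1 ρ, pderiv 0 ρ] (fun i => by
    fin_cases i
    · exact Submodule.neg_mem _ (hk2 ▸ pderiv_mem_polyLE hρm 1)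
    · exact hk2 ▸ pderiv_mem_polyLE hρm 0) 0 (Submodule.zero_mem _)
  -- The rotated field ρ(U₁, -U₀) has zero normal component because U has zero tangential trace; its
  -- divergence is ρ² plus the integrand of `hA`.
  have hF : refInt 2 (∑ i : Fin 2, pderiv i (![ρ * U 1, -(ρ * U 0)] i)) = 0 :=
    refInt_div_eq_zero (n := 1) (fun i => by
      fin_cases i
      · exact dvd_mul_of_dvd_right (ht.X_dvd (by decide)) _
      · exact (dvd_neg).2 (dvd_mul_of_dvd_right (ht.X_dvd (by decide)) _))
    (by
      have : ∑ i, ![ρ * U 1, -(ρ * U 0)] i = ρ * (U 1 - U 0) := by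
        simp [Fin.sum_univ_two]; ring
      rw [this]; exact dvd_mul_of_dvd_right (ht.bary_zero_dvd 1 0) _)
  have h0 : refInt 2 ((∏ j ∈ (∅ : Finset (Fin 3)), bary 2 j) * ρ ^ 2) = 0 := by
    refine Eq.trans ?_ (sub_eq_zero.2 (hF.trans hA.symm))
    rw [← map_sub]
    congr 1
    simp only [Finset.prod_empty, one_mul, Fin.sum_univ_two, Matrix.cons_val_zero,
      Matrix.cons_val_one, map_neg, Derivation.leibniz, smul_eq_mul, mul_zero, add_zero]
    linear_combination ρ * hρ
  have hρ0 := eq_zero_of_refInt_prod_bary_mul_sq h0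
  have hc : pderiv 0 (U 1) = pderiv 1 (U 0) := sub_eq_zero.1 (hρ.symm.trans hρ0)
  refine eq_zero_of_closed hk hU (fun i j => ?_) ht fun B hB => ?_
  · fin_cases i <;> fin_cases j
    exacts [rfl, hc, hc.symm, rfl]
  · simpa using horth 0 (fun _ => Submodule.zero_mem _) B (by simpa using hB)

/-- Unisolvence of the interior moments on the reference tetrahedron. -/
lemma eq_zero_of_tetrahedron {U : Fin 3 → MvPolynomial (Fin 3) ℝ} (hk : 0 ≤ k)
    (hU : ∀ i, U i ∈ polyLE 3 k) (ht : TraceZero U)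
    (horth : ∀ A : Fin 3 → MvPolynomial (Fin 3) ℝ, (∀ i, A i ∈ polyLE 3 (k - 3)) →
      ∀ B ∈ polyLE 3 (k - 3), refInt 3 (∑ i, U i * (A i + X i * B)) = 0) : U = 0 := by
  -- Both tangential components U_a and U_b are divisible by x_i, and differentiation in directions
  -- a and b keeps this factor; hence so is the i-th component of the curl.
  have hV : ∀ i a b : Fin 3, i ≠ a → i ≠ b →
      ∃ w ∈ polyLE 3 (k - 2), pderiv a (U b) - pderiv b (U a) = X i * w := by
    intro i a b ha hb
    obtain ⟨r, hr⟩ := ht.X_dvd ha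
    obtain ⟨s, hs⟩ := ht.X_dvd hb
    have e : pderiv a (U b) - pderiv b (U a) = X i * (pderiv a s - pderiv b r) := by
      rw [hr, hs]
      simp only [Derivation.leibniz, smul_eq_mul, pderiv_X, Pi.single_apply, if_neg ha, if_neg hb]
      ring
    refine ⟨_, ?_, e⟩
    have hm : pderiv a (U b) - pderiv b (U a) ∈ polyLE 3 (k - 1) :=
      Submodule.sub_mem _ (pderiv_mem_polyLE (hU b) a) (pderiv_mem_polyLE (hU a) b)
    rw [e, ← bary_succ] at hm
    have := mem_polyLE_of_bary_mul hm
    rwa [show k - 1 - 1 = k - 2 by ring] at this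
  obtain ⟨w0, hw0, e0⟩ := hV 0 1 2 (by decide) (by decide)
  obtain ⟨w1, hw1, e1⟩ := hV 1 2 0 (by decide) (by decide)
  obtain ⟨w2, hw2, e2⟩ := hV 2 0 1 (by decide) (by decide)
  have hD : ∀ {w w'} (i j : Fin 3), w ∈ polyLE 3 (k - 2) → w' ∈ polyLE 3 (k - 2) →
      pderiv i w - pderiv j w' ∈ polyLE 3 (k - 3) := fun {w w'} i j h h' => by
    have := Submodule.sub_mem _ (pderiv_mem_polyLE h i) (pderiv_mem_polyLE h' j)
    rwa [show k - 2 - 1 = k - 3 by ring] at this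
  -- The test field is curl w, of degree k - 3.
  have hA := horth ![pderiv 1 w2 - pderiv 2 w1, pderiv 2 w0 - pderiv 0 w2,
      pderiv 0 w1 - pderiv 1 w0] (fun i => by
    fin_cases i
    exacts [hD 1 2 hw2 hw1, hD 2 0 hw0 hw2, hD 0 1 hw1 hw0]) 0 (Submodule.zero_mem _)
  have hX : ∀ {i a b : Fin 3} (r s : MvPolynomial (Fin 3) ℝ), i ≠ a → i ≠ b →
      X i ∣ U a * r - U b * s := fun r s ha hb =>
    dvd_sub (dvd_mul_of_dvd_left (ht.X_dvd ha) _) (dvd_mul_of_dvd_left (ht.X_dvd hb) _)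
  -- The field is U × w, with div(U × w) = curl U · w - U · curl w and curl U = (x_i w_i).
  have hF : refInt 3 (∑ i : Fin 3,
      pderiv i (![U 1 * w2 - U 2 * w1, U 2 * w0 - U 0 * w2, U 0 * w1 - U 1 * w0] i)) = 0 :=
    refInt_div_eq_zero (n := 2) (fun i => by
      fin_cases i
      exacts [hX _ _ (by decide) (by decide), hX _ _ (by decide) (by decide),
        hX _ _ (by decide) (by decide)])
    (by
      have : ∑ i, ![U 1 * w2 - U 2 * w1, U 2 * w0 - U 0 * w2, U 0 * w1 - U 1 * w0] i =
          (U 2 - U 1) * w0 + (U 0 - U 2) * w1 + (U 1 - U 0) * w2 := by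
        simp [Fin.sum_univ_three]; ring
      rw [this]
      exact dvd_add (dvd_add (dvd_mul_of_dvd_left (ht.bary_zero_dvd _ _) _)
        (dvd_mul_of_dvd_left (ht.bary_zero_dvd _ _) _))
        (dvd_mul_of_dvd_left (ht.bary_zero_dvd _ _) _))
  have hsum : refInt 3 (X 0 * w0 ^ 2) + refInt 3 (X 1 * w1 ^ 2) + refInt 3 (X 2 * w2 ^ 2) = 0 := by
    rw [← hF, ← add_zero (refInt 3 (∑ i, _)), ← hA, ← map_add, ← map_add, ← map_add]
    congr 1
    simp only [Fin.sum_univ_three, Matrix.cons_val_zero, Matrix.cons_val_one, Matrix.cons_val,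
      map_sub, Derivation.leibniz, smul_eq_mul, mul_zero, add_zero]
    linear_combination - w0 * e0 - w1 * e1 - w2 * e2
  have hb : ∀ (i : Fin 3) (w : MvPolynomial (Fin 3) ℝ),
      X i * w ^ 2 = (∏ j ∈ {i.succ}, bary 3 j) * w ^ 2 := fun i w => by simp
  have hn : ∀ (i : Fin 3) (w : MvPolynomial (Fin 3) ℝ), 0 ≤ refInt 3 (X i * w ^ 2) := fun i w =>
    refInt_nonneg fun y hy => hb i w ▸ eval_prod_bary_mul_sq_nonneg _ w hy
  have hz : ∀ (i : Fin 3) (w : MvPolynomial (Fin 3) ℝ), refInt 3 (X i * w ^ 2) = 0 → w = 0 :=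
    fun i w h => eq_zero_of_refInt_prod_bary_mul_sq (hb i w ▸ h)
  have n0 := hn 0 w0
  have n1 := hn 1 w1
  have n2 := hn 2 w2
  rw [hz 0 w0 (by linarith), mul_zero, sub_eq_zero] at e0
  rw [hz 1 w1 (by linarith), mul_zero, sub_eq_zero] at e1
  rw [hz 2 w2 (by linarith), mul_zero, sub_eq_zero] at e2
  refine eq_zero_of_closed hk hU (fun i j => ?_) ht fun B hB => ?_
  · fin_cases i <;> fin_cases j
    exacts [rfl, e2, e1.symm, e2.symm, rfl, e0, e1, e0.symm, rfl]
  · simpa using horth 0 (fun _ => Submodule.zero_mem _) B (by norm_num at hB ⊢; exact hB)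

end Reference

/-! ### Affine coordinates on a simplex in space. -/

section Parametrization

variable {d : ℕ} {k : ℤ} (s : Affine.Simplex ℝ E3 d)

/-- The edge vectors of a simplex issuing from its first vertex. -/
noncomputable def edgeVec (i : Fin d) : E3 := s.points i.succ - s.points 0

/-- The linear part of the parametrization of a simplex by the reference simplex. -/
noncomputable def simplexLin : (Fin d → ℝ) →ₗ[ℝ] E3 := Fintype.linearCombination ℝ (edgeVec s)

lemma simplexLin_apply (v : Fin d → ℝ) : simplexLin s v = ∑ i, v i • edgeVec s i := rfl

/-- The parametrization of a simplex by the reference simplex. -/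
noncomputable def simplexMap (y : Fin d → ℝ) : E3 := s.points 0 + simplexLin s y

lemma simplexLin_eq (v : Fin d → ℝ) : simplexLin s v = ∑ j, baryLin v j • s.points j := by
  simp only [simplexLin_apply, edgeVec, Fin.sum_univ_succ, baryLin_zero, baryLin_succ, smul_sub,
    Finset.sum_sub_distrib, neg_smul, Finset.sum_smul]
  abel

lemma simplexMap_eq (y : Fin d → ℝ) : simplexMap s y = ∑ j, baryVal y j • s.points j := by
  simp only [simplexMap, simplexLin_apply, edgeVec, Fin.sum_univ_succ, baryVal_zero, baryVal_succ,
    smul_sub, Finset.sum_sub_distrib, sub_smul, one_smul, Finset.sum_smul]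
  abel

lemma linearIndependent_edgeVec : LinearIndependent ℝ (edgeVec s) := by
  have h := (affineIndependent_iff_linearIndependent_vsub ℝ s.points 0).1 s.independent
  exact h.comp (fun i : Fin d => ⟨i.succ, Fin.succ_ne_zero i⟩)
    fun i j hij => Fin.succ_injective _ (congrArg Subtype.val hij)

lemma simplexLin_injective : Function.Injective (simplexLin s) :=
  (linearIndependent_edgeVec s).fintypeLinearCombination_injective

lemma range_simplexLin : LinearMap.range (simplexLin s) = tangentDir s := by
  rw [simplexLin, Fintype.range_linearCombination, tangentDir, direction_affineSpan,
    vectorSpan_range_eq_span_range_vsub_right ℝ s.points 0]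
  apply le_antisymm
  · refine Submodule.span_mono ?_
    rintro _ ⟨i, rfl⟩
    exact ⟨i.succ, rfl⟩
  · rw [Submodule.span_le]
    rintro _ ⟨i, rfl⟩
    cases i using Fin.cases with
    | zero => simp
    | succ i => exact Submodule.subset_span ⟨i, rfl⟩

lemma finrank_tangentDir : Module.finrank ℝ (tangentDir s) = d := by
  rw [← range_simplexLin, LinearMap.finrank_range_of_inj (simplexLin_injective s)]
  simp

lemma edgeVec_mem (i : Fin d) : edgeVec s i ∈ tangentDir s := by
  rw [← range_simplexLin]
  exact ⟨Pi.single i 1, by simp [simplexLin_apply, Pi.single_apply]⟩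

/-- A linear left inverse of the linear part of the parametrization. -/
noncomputable def simplexLinInv : E3 →ₗ[ℝ] (Fin d → ℝ) :=
  (LinearMap.exists_leftInverse_of_injective (simplexLin s)
    (LinearMap.ker_eq_bot.2 (simplexLin_injective s))).choose

lemma simplexLinInv_simplexLin (v : Fin d → ℝ) : simplexLinInv s (simplexLin s v) = v :=
  LinearMap.congr_fun (LinearMap.exists_leftInverse_of_injective (simplexLin s)
    (LinearMap.ker_eq_bot.2 (simplexLin_injective s))).choose_spec v

/-- The affine coordinates of a point of a simplex. -/
noncomputable def simplexInv (x : E3) : Fin d → ℝ := simplexLinInv s (x - s.points 0)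

@[simp] lemma simplexInv_simplexMap (y : Fin d → ℝ) : simplexInv s (simplexMap s y) = y := by
  rw [simplexInv, simplexMap, add_sub_cancel_left, simplexLinInv_simplexLin]

lemma simplexMap_mem_body {y : Fin d → ℝ} (hy : y ∈ refSimplex d) : simplexMap s y ∈ body s := by
  rw [body, ← Affine.Simplex.convexHull_eq_closedInterior, simplexMap_eq]
  exact (convex_convexHull ℝ _).sum_mem (fun j _ => hy j) (sum_baryVal y)
    fun j _ => subset_convexHull ℝ _ ⟨j, rfl⟩

lemma exists_of_mem_body {x : E3} (hx : x ∈ body s) : ∃ y ∈ refSimplex d, simplexMap s y = x := by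
  obtain ⟨w, hw, hI, rfl⟩ := hx
  rw [Finset.affineCombination_eq_linear_combination _ _ _ hw]
  have e : baryVal (fun i : Fin d => w i.succ) = w := by
    ext j
    cases j using Fin.cases with
    | zero => rw [baryVal_zero, ← hw, Fin.sum_univ_succ]; ring
    | succ i => rfl
  exact ⟨fun i => w i.succ, fun j => e ▸ (hI j).1, by rw [simplexMap_eq, e]⟩

lemma simplexInv_mem {x : E3} (hx : x ∈ body s) : simplexInv s x ∈ refSimplex d := by
  obtain ⟨y, hy, rfl⟩ := exists_of_mem_body s hx
  rwa [simplexInv_simplexMap]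

lemma simplexMap_simplexInv {x : E3} (hx : x ∈ body s) : simplexMap s (simplexInv s x) = x := by
  obtain ⟨y, hy, rfl⟩ := exists_of_mem_body s hx
  rw [simplexInv_simplexMap]

lemma simplexMap_refVertex (j : Fin (d + 1)) : simplexMap s (refVertex j) = s.points j := by
  simp [simplexMap_eq, baryVal_refVertex]

/-- The polynomial in the affine coordinates of `s` that agrees with a polynomial on `ℝ³`. -/
noncomputable def pullPoly : MvPolynomial (Fin 3) ℝ →ₐ[ℝ] MvPolynomial (Fin d) ℝ :=
  aeval fun i => ∑ j, C (s.points j i) * bary d j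

/-- A polynomial on `ℝ³` extending a polynomial in the affine coordinates of `s`. -/
noncomputable def pushPoly : MvPolynomial (Fin d) ℝ →ₐ[ℝ] MvPolynomial (Fin 3) ℝ :=
  aeval fun i => ∑ j, C (simplexLinInv s (EuclideanSpace.single j 1) i) *
    (X j - C (s.points 0 j))

lemma eval_pullPoly (q : MvPolynomial (Fin 3) ℝ) (y : Fin d → ℝ) :
    eval y (pullPoly s q) = eval (fun i => simplexMap s y i) q := by
  rw [pullPoly, eval_aeval]
  congr 2
  ext i
  simp [simplexMap_eq, mul_comm]

lemma eval_pushPoly (q : MvPolynomial (Fin d) ℝ) (x : E3) :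
    eval (fun i => x i) (pushPoly s q) = eval (simplexInv s x) q := by
  rw [pushPoly, eval_aeval]
  congr 2
  ext i
  have : x - s.points 0 = ∑ j, (x j - s.points 0 j) • (EuclideanSpace.single j 1 : E3) := by
    ext k; simp [Pi.single_apply]
  rw [simplexInv, this]
  simp [mul_comm]

lemma pullPoly_mem {q : MvPolynomial (Fin 3) ℝ} (hq : q ∈ polyLE 3 k) :
    pullPoly s q ∈ polyLE d k :=
  aeval_mem_polyLE (fun i => Submodule.sum_mem _ fun j _ => by
    rw [← smul_eq_C_mul]; exact Submodule.smul_mem _ _ (bary_mem_polyLE j)) hq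

lemma pushPoly_mem {q : MvPolynomial (Fin d) ℝ} (hq : q ∈ polyLE d k) :
    pushPoly s q ∈ polyLE 3 k :=
  aeval_mem_polyLE (fun i => Submodule.sum_mem _ fun j _ => by
    rw [← smul_eq_C_mul]
    exact Submodule.smul_mem _ _ (Submodule.sub_mem _ (X_mem_polyLE j le_rfl)
      (C_mem_polyLE _ zero_le_one))) hq

/-- A polynomial in the affine coordinates of `s` as a function on `s`. -/
noncomputable def simplexFun : MvPolynomial (Fin d) ℝ →ₗ[ℝ] (body s → ℝ) where
  toFun q := fun x => eval (simplexInv s x) q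
  map_add' p q := by ext x; simp
  map_smul' c q := by ext x; simp [smul_eval]

lemma simplexFun_apply (q : MvPolynomial (Fin d) ℝ) (x : body s) :
    simplexFun s q x = eval (simplexInv s x) q := rfl

lemma simplexFun_injective : Function.Injective (simplexFun s) := by
  rw [← LinearMap.ker_eq_bot, LinearMap.ker_eq_bot']
  intro q hq
  refine eq_zero_of_refSimplex fun y hy => ?_
  have := congrFun hq ⟨_, simplexMap_mem_body s hy⟩
  simpa [simplexFun_apply] using this

lemma simplexFun_pullPoly (q : MvPolynomial (Fin 3) ℝ) (x : body s) :
    simplexFun s (pullPoly s q) x = eval (fun i => x.1 i) q := by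
  rw [simplexFun_apply, eval_pullPoly, simplexMap_simplexInv s x.2]

/-- Pulling back to affine coordinates and extending to ℝ³ are both affine substitutions, so the
degree bound is the same intrinsically and in the ambient space. -/
lemma map_simplexFun (k : ℤ) : (polyLE d k).map (simplexFun s) = polyFun k (body s) := by
  ext g
  constructor
  · rintro ⟨q, hq, rfl⟩
    exact ⟨pushPoly s q, pushPoly_mem s hq, fun x => (eval_pushPoly s q x).symm⟩
  · rintro ⟨q, hq, hg⟩
    exact ⟨pullPoly s q, pullPoly_mem s hq, by ext x; rw [simplexFun_pullPoly, hg]⟩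

lemma simplexFun_mem {q : MvPolynomial (Fin d) ℝ} (hq : q ∈ polyLE d k) :
    simplexFun s q ∈ polyFun k (body s) := by
  rw [← map_simplexFun]; exact ⟨q, hq, rfl⟩

end Parametrization

/-! ### Hausdorff measure of a simplex in affine coordinates. -/

section Measure

variable {d : ℕ} (s : Affine.Simplex ℝ E3 d)

lemma isometry_coe_body : Isometry ((↑) : body s → E3) := isometry_subtype_coe

lemma measurableSet_body : MeasurableSet (body s) := s.isClosed_closedInterior.measurableSet

lemma continuous_simplexInv : Continuous fun x : body s => simplexInv s x := by
  have : Continuous (simplexLinInv s) := (simplexLinInv s).continuous_of_finiteDimensional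
  exact this.comp (continuous_subtype_val.sub continuous_const)

/-- The surface measure of a simplex is, in affine coordinates, a multiple of the Lebesgue measure
of the reference simplex. -/
lemma exists_map_euclideanHausdorffMeasure : ∃ c : NNReal, 0 < c ∧
    (μHE[d] : Measure (body s)).map (fun x : body s => simplexInv s x) =
      c • volume.restrict (refSimplex d) := by
  let e : (Fin d → ℝ) ≃ₗ[ℝ] LinearMap.range (simplexLin s) :=
    LinearEquiv.ofInjective _ (simplexLin_injective s)
  have hd : Module.finrank ℝ (LinearMap.range (simplexLin s)) = d := by
    rw [range_simplexLin, finrank_tangentDir]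
  let G : LinearMap.range (simplexLin s) ≃ₗᵢ[ℝ] EuclideanSpace ℝ (Fin d) :=
    ((stdOrthonormalBasis ℝ _).reindex (finCongr hd)).repr
  let A : EuclideanSpace ℝ (Fin d) ≃L[ℝ] (Fin d → ℝ) :=
    (G.symm.toLinearEquiv.trans e.symm).toContinuousLinearEquiv
  have hmem : ∀ x : body s, x.1 - s.points 0 ∈ LinearMap.range (simplexLin s) := fun x => by
    obtain ⟨y, -, hy⟩ := exists_of_mem_body s x.2
    exact ⟨y, by rw [← hy, simplexMap, add_sub_cancel_left]⟩
  -- An isometry into ℝ^d, so it carries Hausdorff measure to Lebesgue measure on its image; `A`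
  -- then passes to affine coordinates, and uniqueness of Haar measure supplies the constant.
  let κ : body s → EuclideanSpace ℝ (Fin d) := fun x => G ⟨x.1 - s.points 0, hmem x⟩
  have hκ : Isometry κ := G.isometry.comp
    (Isometry.of_dist_eq fun x y => by
      rw [Subtype.dist_eq, Subtype.dist_eq]; simp)
  have hAκ : ∀ x, A (κ x) = simplexInv s x := by
    intro x
    obtain ⟨y, -, hy⟩ := exists_of_mem_body s x.2
    have h1 : A (κ x) = e.symm ⟨x.1 - s.points 0, hmem x⟩ := by simp [A, κ]
    rw [h1, LinearEquiv.symm_apply_eq]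
    ext1
    have h2 : simplexMap s (simplexInv s x) = x := simplexMap_simplexInv s x.2
    rw [simplexMap, ← eq_sub_iff_add_eq'] at h2
    exact h2.symm
  have hA : Measurable A := A.continuous.measurable
  have hrange : A ⁻¹' (refSimplex d) = Set.range κ := by
    ext z
    constructor
    · intro hz
      refine ⟨⟨simplexMap s (A z), simplexMap_mem_body s hz⟩, A.injective ?_⟩
      rw [hAκ, simplexInv_simplexMap]
    · rintro ⟨x, rfl⟩
      rw [Set.mem_preimage, hAκ]
      exact simplexInv_mem s x.2
  refine ⟨(Measure.map A volume).addHaarScalarFactor volume,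
    Measure.addHaarScalarFactor_pos_of_isAddHaarMeasure _ _, ?_⟩
  have h1 : (fun x : body s => simplexInv s x) = A ∘ κ := by ext1 x; exact (hAκ x).symm
  rw [h1, ← Measure.map_map hA hκ.continuous.measurable, hκ.map_euclideanHausdorffMeasure,
    EuclideanSpace.euclideanHausdorffMeasure_eq_volume, ← hrange,
    ← Measure.restrict_map hA (measurableSet_refSimplex d), ← Measure.restrict_smul]
  congr 1
  exact Measure.isAddLeftInvariant_eq_smul _ _

instance : IsFiniteMeasure (μHE[d] : Measure (body s)) := by
  obtain ⟨c, -, h⟩ := exists_map_euclideanHausdorffMeasure s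
  have : IsFiniteMeasure (volume.restrict (refSimplex d)) :=
    ⟨by simpa using (isCompact_refSimplex d).measure_lt_top⟩
  have : IsFiniteMeasure ((μHE[d] : Measure (body s)).map (fun x : body s => simplexInv s x)) := by
    rw [h]; infer_instance
  exact Measure.isFiniteMeasure_of_map (continuous_simplexInv s).aemeasurable

lemma exists_integral_simplexFun : ∃ c : ℝ, 0 < c ∧ ∀ q : MvPolynomial (Fin d) ℝ,
    ∫ x, simplexFun s q x ∂μHE[d] = c * refInt d q := by
  obtain ⟨c, hc, h⟩ := exists_map_euclideanHausdorffMeasure s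
  refine ⟨c, hc, fun q => ?_⟩
  have := integral_map (μ := (μHE[d] : Measure (body s)))
    (continuous_simplexInv s).aemeasurable (f := fun y => eval y q)
    (continuous_eval_poly q).aestronglyMeasurable
  rw [h, integral_smul_nnreal_measure] at this
  exact this.symm

lemma comap_volume_eq (t : Affine.Simplex ℝ E3 3) :
    (volume.comap Subtype.val : Measure (body t)) = μHE[3] := by
  have hm := MeasurableEmbedding.subtype_coe (measurableSet_body t)
  rw [← hm.comap_map (μHE[3] : Measure (body t)), (isometry_coe_body t).map_euclideanHausdorffMeasure,
    EuclideanSpace.euclideanHausdorffMeasure_eq_volume, hm.comap_restrict]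
  simp

end Measure

/-! ### Covariant components of vector fields and their traces on facets. -/

section Fields

variable {d : ℕ} {k : ℤ} (s : Affine.Simplex ℝ E3 d)

/-- The vector field on `ℝ³` with polynomial components `Q`. -/
noncomputable def vecField (Q : Fin 3 → MvPolynomial (Fin 3) ℝ) (x : E3) : E3 :=
  WithLp.toLp 2 fun i => eval (fun l => x l) (Q i)

lemma exists_vecField {S : Set E3} {u : S → E3} (hu : u ∈ polyField k S) :
    ∃ Q : Fin 3 → MvPolynomial (Fin 3) ℝ, (∀ i, Q i ∈ polyLE 3 k) ∧ ∀ x, u x = vecField Q x := by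
  choose Q hQ h using hu
  exact ⟨Q, hQ, fun x => by ext i; exact h i x⟩

/-- The component of a polynomial vector field along `w`, in the affine coordinates of `s`. -/
noncomputable def dotPoly (Q : Fin 3 → MvPolynomial (Fin 3) ℝ) (w : E3) :
    MvPolynomial (Fin d) ℝ :=
  pullPoly s (∑ i, w i • Q i)

lemma eval_dotPoly (Q : Fin 3 → MvPolynomial (Fin 3) ℝ) (w : E3) (y : Fin d → ℝ) :
    eval y (dotPoly s Q w) = inner ℝ (vecField Q (simplexMap s y)) w := by
  rw [dotPoly, eval_pullPoly]
  simp [vecField, PiLp.inner_apply, smul_eval]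

lemma dotPoly_mem {Q : Fin 3 → MvPolynomial (Fin 3) ℝ} (hQ : ∀ i, Q i ∈ polyLE 3 k) (w : E3) :
    dotPoly s Q w ∈ polyLE d k :=
  pullPoly_mem s (Submodule.sum_mem _ fun i _ => Submodule.smul_mem _ _ (hQ i))

lemma sum_simplexFun_smul_mem {ι : Type*} [Fintype ι] {A : ι → MvPolynomial (Fin d) ℝ}
    (hA : ∀ i, A i ∈ polyLE d k) (c : ι → E3) :
    (fun x => ∑ i, simplexFun s (A i) x • c i) ∈ polyField k (body s) := by
  intro l
  have : (fun x => (∑ i, simplexFun s (A i) x • c i) l) =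
      simplexFun s (∑ i, c i l • A i) := by
    ext x
    simp [simplexFun_apply, smul_eval, mul_comm]
  rw [this]
  exact simplexFun_mem s (Submodule.sum_mem _ fun i _ => Submodule.smul_mem _ _ (hA i))

lemma sum_simplexInv_smul_edgeVec (x : body s) :
    ∑ i, simplexInv s x i • edgeVec s i = x.1 - s.points 0 := by
  have h : simplexMap s (simplexInv s x) = x := simplexMap_simplexInv s x.2
  rw [simplexMap, ← eq_sub_iff_add_eq'] at h
  exact h

variable {s}

/-- Requiring only that `s'` contain the vertices other than j among its own makes the result
independent of how vertices are numbered. -/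
lemma simplexMap_mem_facet {d' : ℕ} {s' : Affine.Simplex ℝ E3 d'} {j : Fin (d + 1)}
    (h : ∀ i, i ≠ j → s.points i ∈ Set.range s'.points) {y : Fin d → ℝ} (hy : y ∈ refSimplex d)
    (hj : baryVal y j = 0) : simplexMap s y ∈ body s' := by
  have e := Finset.sum_erase_add _ (fun i => baryVal y i • s.points i) (Finset.mem_univ j)
  have e1 := Finset.sum_erase_add _ (fun i => baryVal y i) (Finset.mem_univ j)
  rw [hj, zero_smul, add_zero] at e
  rw [hj, add_zero, sum_baryVal] at e1
  rw [simplexMap_eq, ← e, body, ← Affine.Simplex.convexHull_eq_closedInterior]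
  exact (convex_convexHull ℝ _).sum_mem (fun j _ => hy j) e1
    fun i hi => subset_convexHull ℝ _ (h i (Finset.ne_of_mem_erase hi))

lemma simplexLin_mem_facet {d' : ℕ} {s' : Affine.Simplex ℝ E3 d'} {j : Fin (d + 1)}
    (h : ∀ i, i ≠ j → s.points i ∈ Set.range s'.points) {v : Fin d → ℝ}
    (hj : baryLin v j = 0) : simplexLin s v ∈ tangentDir s' := by
  have e : simplexLin s v = ∑ i, baryLin v i • (s.points i - s'.points 0) := by
    simp only [smul_sub, Finset.sum_sub_distrib, ← Finset.sum_smul, sum_baryLin, zero_smul,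
      sub_zero, simplexLin_eq]
  rw [e]
  refine Submodule.sum_mem _ fun i _ => ?_
  by_cases hi : i = j
  · rw [hi, hj, zero_smul]; exact Submodule.zero_mem _
  · rw [tangentDir, direction_affineSpan]
    exact Submodule.smul_mem _ _ (vsub_mem_vectorSpan ℝ (h i hi) ⟨0, rfl⟩)

variable (s)

/-- The tangential component of the polynomial vector field `Q` vanishes on `s`. -/
def TangentZero (Q : Fin 3 → MvPolynomial (Fin 3) ℝ) : Prop :=
  ∀ x ∈ body s, ∀ w ∈ tangentDir s, inner ℝ (vecField Q x) w = 0

variable {s}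

lemma sum_mul_eval_dotPoly (Q : Fin 3 → MvPolynomial (Fin 3) ℝ) (y v : Fin d → ℝ) :
    ∑ i, v i * eval y (dotPoly s Q (edgeVec s i)) =
      inner ℝ (vecField Q (simplexMap s y)) (simplexLin s v) := by
  simp only [eval_dotPoly, simplexLin_apply, inner_sum, inner_smul_right]

lemma traceZero_of_facets {d' : ℕ} {Q : Fin 3 → MvPolynomial (Fin 3) ℝ}
    (h : ∀ j, ∃ s' : Affine.Simplex ℝ E3 d', (∀ i, i ≠ j → s.points i ∈ Set.range s'.points) ∧
      TangentZero s' Q) : TraceZero fun i => dotPoly s Q (edgeVec s i) := by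
  intro j y hy hyj v hv
  obtain ⟨s', hs', hz⟩ := h j
  rw [sum_mul_eval_dotPoly]
  exact hz _ (simplexMap_mem_facet hs' hy hyj) _ (simplexLin_mem_facet hs' hv)

lemma tangentZero_of_dotPoly {Q : Fin 3 → MvPolynomial (Fin 3) ℝ}
    (h : (fun i => dotPoly s Q (edgeVec s i)) = 0) : TangentZero s Q := by
  intro x hx w hw
  rw [← range_simplexLin] at hw
  obtain ⟨v, rfl⟩ := hw
  rw [← simplexMap_simplexInv s hx, ← sum_mul_eval_dotPoly]
  exact Finset.sum_eq_zero fun i _ => by rw [congrFun h i]; simp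

/-- The field with components `A i + X i * B` in the affine frame of `s`. -/
lemma sum_simplexFun_radial (A : Fin d → MvPolynomial (Fin d) ℝ) (B : MvPolynomial (Fin d) ℝ)
    (x : body s) :
    ∑ i, simplexFun s (A i + X i * B) x • edgeVec s i =
      ∑ i, simplexFun s (A i) x • edgeVec s i + simplexFun s B x • (x.1 - s.points 0) := by
  rw [← sum_simplexInv_smul_edgeVec, Finset.smul_sum, ← Finset.sum_add_distrib]
  refine Finset.sum_congr rfl fun i _ => ?_
  simp only [simplexFun_apply, map_add, map_mul, eval_X]
  rw [add_smul, smul_smul, mul_comm]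

/-- Covariant components of one field pair with contravariant components of the other, so no Gram
matrix appears. -/
lemma inner_sum_simplexFun (Q : Fin 3 → MvPolynomial (Fin 3) ℝ)
    (W : Fin d → MvPolynomial (Fin d) ℝ) (x : body s) :
    inner ℝ (vecField Q x) (∑ i, simplexFun s (W i) x • edgeVec s i) =
      simplexFun s (∑ i, dotPoly s Q (edgeVec s i) * W i) x := by
  simp only [simplexFun_apply, map_sum, map_mul, eval_dotPoly, simplexMap_simplexInv s x.2,
    inner_sum, inner_smul_right]
  exact Finset.sum_congr rfl fun i _ => mul_comm _ _

lemma refInt_eq_zero_of_integral {q : MvPolynomial (Fin d) ℝ}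
    (h : ∫ x, simplexFun s q x ∂μHE[d] = 0) : refInt d q = 0 := by
  obtain ⟨c, hc, hi⟩ := exists_integral_simplexFun s
  rw [hi] at h
  exact (mul_eq_zero.1 h).resolve_left hc.ne'

end Fields

/-! ### Rotation by the normal of a face. -/

section CrossProduct

/-- Lagrange's identity. It turns a face moment of u × ν against w × ν into a moment of u against
the tangential field w. -/
lemma inner_cross_cross (u w ν : E3) (hν : ‖ν‖ = 1) (hw : inner ℝ w ν = 0) :
    inner ℝ (cross u ν) (cross w ν) = inner ℝ u w := by
  have h1 : inner ℝ ν ν = (1 : ℝ) := by rw [real_inner_self_eq_norm_sq, hν]; norm_num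
  simp only [PiLp.inner_apply, Fin.sum_univ_three, RCLike.inner_apply, conj_trivial] at h1 hw ⊢
  simp only [cross, cross_apply, Matrix.cons_val_zero, Matrix.cons_val_one, Matrix.cons_val]
  linear_combination (w.ofLp 0 * u.ofLp 0 + w.ofLp 1 * u.ofLp 1 + w.ofLp 2 * u.ofLp 2) * h1
    - (u.ofLp 0 * ν.ofLp 0 + u.ofLp 1 * ν.ofLp 1 + u.ofLp 2 * ν.ofLp 2) * hw

lemma inner_cross_right (w ν : E3) : inner ℝ ν (cross w ν) = 0 := by
  simp only [PiLp.inner_apply, Fin.sum_univ_three, RCLike.inner_apply, conj_trivial, cross,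
    cross_apply, Matrix.cons_val_zero, Matrix.cons_val_one, Matrix.cons_val]
  ring

/-- The vector product with a fixed vector, as a linear map. -/
noncomputable def crossRight (ν : E3) : E3 →ₗ[ℝ] E3 where
  toFun w := cross w ν
  map_add' v w := by simp [cross]
  map_smul' c w := by simp [cross]

@[simp] lemma crossRight_apply (w ν : E3) : crossRight ν w = cross w ν := rfl

lemma cross_anticomm_E3 (v w : E3) : cross v w = -cross w v := by
  rw [cross, cross, ← cross_anticomm, WithLp.toLp_neg]

lemma mem_tangentDir_of_inner_eq_zero {s : Affine.Simplex ℝ E3 2} {ν w : E3} (hν : ‖ν‖ = 1)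
    (hn : ν ∈ (tangentDir s)ᗮ) (hw : inner ℝ ν w = 0) : w ∈ tangentDir s := by
  have h0 : ν ≠ 0 := fun h => by simp [h] at hν
  have : Fact (Module.finrank ℝ E3 = 2 + 1) := ⟨by simp⟩
  have hle : tangentDir s ≤ (Submodule.span ℝ {ν})ᗮ := fun x hx =>
    Submodule.mem_orthogonal_singleton_iff_inner_right.2
      ((Submodule.mem_orthogonal' _ _).1 hn x hx)
  rw [Submodule.eq_of_le_of_finrank_eq hle
    (by rw [finrank_tangentDir, Submodule.finrank_orthogonal_span_singleton (n := 2) h0])]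
  exact Submodule.mem_orthogonal_singleton_iff_inner_right.2 hw

end CrossProduct

/-! ### Vanishing moments force vanishing tangential traces on edges, faces and cell. -/

section Unisolvence

variable {k : ℤ} {t : Affine.Simplex ℝ E3 3} {u : body t → E3}
  {Q : Fin 3 → MvPolynomial (Fin 3) ℝ}

lemma tangentZero_edge (hQ : ∀ i, Q i ∈ polyLE 3 k) (hu : ∀ x, u x = vecField Q x) {e : EdgeIdx}
    {τ : E3} (hτ : ‖τ‖ = 1 ∧ τ ∈ tangentDir (edge t e)) (hv : ∀ i, vertexDof t u i = 0)
    (hm : ∀ q ∈ polyFun (k - 2) (body (edge t e)), edgeDof t u e τ q = 0) :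
    TangentZero (edge t e) Q := by
  have h0 : dotPoly (edge t e) Q τ = 0 := by
    refine eq_zero_of_segment (dotPoly_mem _ hQ τ) (fun j => ?_) fun q hq => ?_
    · have h1 := hv (e.1.orderEmbOfFin e.2 j)
      rw [vertexDof, hu] at h1
      rw [eval_dotPoly, simplexMap_refVertex, Affine.Simplex.face_points, h1, inner_zero_left]
    · refine refInt_eq_zero_of_integral (s := edge t e) ?_
      rw [← hm _ (simplexFun_mem _ hq)]
      refine integral_congr_ae (Filter.Eventually.of_forall fun x => ?_)
      simp only [simplexFun_apply, map_mul, eval_dotPoly, simplexMap_simplexInv _ x.2, hu]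
      rfl
  intro x hx w hw
  have hτ0 : (⟨τ, hτ.2⟩ : tangentDir (edge t e)) ≠ 0 := fun h => by
    have : τ = 0 := congrArg Subtype.val h
    have := hτ.1
    simp_all
  obtain ⟨c, hc⟩ := (finrank_eq_one_iff_of_nonzero' _ hτ0).1 (finrank_tangentDir (edge t e)) ⟨w, hw⟩
  have hc' : c • τ = w := congrArg Subtype.val hc
  have := eval_dotPoly (edge t e) Q τ (simplexInv (edge t e) x)
  rw [h0, map_zero, simplexMap_simplexInv _ hx] at this
  rw [← hc', inner_smul_right, ← this, mul_zero]

/-- Rotation by ν carries the tangential fields A + yB, which test the reference triangle, into the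
Nédélec space. -/
lemma tangentZero_face (hk : 0 ≤ k) (hQ : ∀ i, Q i ∈ polyLE 3 k)
    (hu : ∀ x, u x = vecField Q x) {f : FaceIdx} {ν : E3}
    (hν : ‖ν‖ = 1 ∧ ν ∈ (tangentDir (face t f))ᗮ) (he : ∀ e, TangentZero (edge t e) Q)
    (hm : ∀ ω ∈ nedelecFace (k - 1) (face t f) ν, faceDof t u f ν ω = 0) :
    TangentZero (face t f) Q := by
  set s := face t f with hs
  refine tangentZero_of_dotPoly (eq_zero_of_triangle hk (fun i => dotPoly_mem _ hQ _)
    (traceZero_of_facets (d' := 1) fun j => ?_) fun A hA B hB => ?_)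
  · have hmem : f.1.orderEmbOfFin f.2 j ∈ f.1 := Finset.orderEmbOfFin_mem _ _ _
    refine ⟨edge t ⟨f.1.erase (f.1.orderEmbOfFin f.2 j), ?_⟩, fun i hi => ?_, he _⟩
    · rw [Finset.card_erase_of_mem hmem, f.2]
    · rw [Affine.Simplex.range_face_points, hs, Affine.Simplex.face_points]
      refine ⟨_, ?_, rfl⟩
      simp [hi]
  · have hW : ∀ x : body s, ∑ i, simplexFun s (A i + X i * B) x • edgeVec s i ∈ tangentDir s :=
      fun x => Submodule.sum_mem _ fun i _ => Submodule.smul_mem _ _ (edgeVec_mem s i)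
    have hk2 : k - 1 - 1 = k - 2 := by ring
    refine refInt_eq_zero_of_integral (s := s) ?_
    rw [← hm (fun x => cross (∑ i, simplexFun s (A i + X i * B) x • edgeVec s i) ν) ?_]
    · refine integral_congr_ae (Filter.Eventually.of_forall fun x => ?_)
      change _ = inner ℝ (cross (u (faceIncl t f x)) ν) (cross _ ν)
      rw [inner_cross_cross _ _ _ hν.1 ((Submodule.mem_orthogonal _ _).1 hν.2 _ (hW x)), hu]
      exact (inner_sum_simplexFun Q _ x).symm
    -- The sign of B changes because the Nédélec space is written with ν on the left of the vector
    -- product.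
    · have e : (fun x : body s => cross (∑ i, simplexFun s (A i + X i * B) x • edgeVec s i) ν) =
          (fun x => ∑ i, simplexFun s (A i) x • cross (edgeVec s i) ν) +
            mulField (fun x : body s => cross ν (x.1 - s.points 0)) (simplexFun s (-B)) := by
        ext1 x
        rw [sum_simplexFun_radial, ← crossRight_apply, map_add, map_sum]
        simp only [map_smul, crossRight_apply, Pi.add_apply, mulField, LinearMap.coe_mk,
          AddHom.coe_mk, map_neg, Pi.neg_apply]
        rw [cross_anticomm_E3 ν, smul_neg, neg_neg]
      rw [e]
      refine Submodule.add_mem_sup ⟨?_, fun x => ?_⟩ ⟨_, ?_, rfl⟩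
      · rw [hk2]; exact sum_simplexFun_smul_mem s hA _
      · exact Submodule.sum_mem _ fun i _ => Submodule.smul_mem _ _
          (mem_tangentDir_of_inner_eq_zero hν.1 hν.2 (inner_cross_right _ _))
      · rw [hk2]; exact simplexFun_mem s (Submodule.neg_mem _ hB)

lemma eq_zero_of_cell (hk : 0 ≤ k) (hQ : ∀ i, Q i ∈ polyLE 3 k)
    (hu : ∀ x, u x = vecField Q x) (hf : ∀ f, TangentZero (face t f) Q)
    (hm : ∀ η ∈ raviartThomas (k - 2) t, cellDof t u η = 0) : u = 0 := by
  have hz : TangentZero t Q := by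
    refine tangentZero_of_dotPoly (eq_zero_of_tetrahedron hk (fun i => dotPoly_mem _ hQ _)
      (traceZero_of_facets (d' := 2) fun j => ?_) fun A hA B hB => ?_)
    · refine ⟨face t ⟨Finset.univ.erase j, by simp⟩, fun i hi => ?_, hf _⟩
      rw [Affine.Simplex.range_face_points]
      exact ⟨i, by simpa using hi, rfl⟩
    · have hk3 : k - 2 - 1 = k - 3 := by ring
      refine refInt_eq_zero_of_integral (s := t) ?_
      rw [← hm (fun x => ∑ i, simplexFun t (A i + X i * B) x • edgeVec t i) ?_, cellDof,
        comap_volume_eq]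
      · refine integral_congr_ae (Filter.Eventually.of_forall fun x => ?_)
        change _ = inner ℝ (u x) (∑ i, simplexFun t (A i + X i * B) x • edgeVec t i)
        rw [hu]
        exact (inner_sum_simplexFun Q _ x).symm
      -- The radial field is centred at the first vertex; the shift -B x_0 to the origin is absorbed
      -- in the part of degree p - 3. The sum over `Fin 1` fits it to `sum_simplexFun_smul_mem`.
      · have e : (fun x : body t => ∑ i, simplexFun t (A i + X i * B) x • edgeVec t i) =
            ((fun x => ∑ i, simplexFun t (A i) x • edgeVec t i) +
              fun x => ∑ _i : Fin 1, simplexFun t B x • (-t.points 0)) +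
            mulField (fun x : body t => x.1) (simplexFun t B) := by
          ext1 x
          rw [sum_simplexFun_radial]
          simp [mulField, sub_eq_add_neg, add_assoc, add_comm]
        rw [e]
        refine Submodule.add_mem_sup (Submodule.add_mem _ ?_ ?_) ⟨_, ?_, rfl⟩ <;> rw [hk3]
        · exact sum_simplexFun_smul_mem t hA _
        · exact sum_simplexFun_smul_mem t (fun _ => hB) _
        · exact simplexFun_mem t hB
  have htop : tangentDir t = ⊤ :=
    Submodule.eq_top_of_finrank_eq (by rw [finrank_tangentDir]; simp)
  ext1 x
  have h := hz x x.2 (vecField Q x) (htop ▸ Submodule.mem_top)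
  rw [hu, inner_self_eq_zero.1 h]; rfl

end Unisolvence

/-! ### Dimensions of polynomial spaces. -/

section Dimension

variable {d : ℕ} {k : ℤ}

/-- The homogeneous polynomials of degree `k` in `d` variables. -/
noncomputable def polyHom (d : ℕ) (k : ℤ) : Submodule ℝ (MvPolynomial (Fin d) ℝ) :=
  restrictSupport ℝ {m | (m.degree : ℤ) = k}

lemma finite_of_eq_coe {S : Set (Fin d →₀ ℕ)} {F : Finset (Fin d →₀ ℕ)} (h : S = F) :
    Module.Finite ℝ (restrictSupport ℝ S) ∧
      Module.finrank ℝ (restrictSupport ℝ S) = F.card := by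
  subst h
  exact ⟨Module.Finite.of_basis (basisRestrictSupport ℝ _),
    by rw [Module.finrank_eq_card_basis (basisRestrictSupport ℝ _)]; simp⟩

lemma mem_finsuppAntidiag_univ {m : Fin d →₀ ℕ} {i : ℕ} :
    m ∈ (Finset.univ : Finset (Fin d)).finsuppAntidiag i ↔ m.degree = i := by
  rw [Finset.mem_finsuppAntidiag, Finsupp.degree_eq_sum]
  simp

lemma degree_le_set_eq (d : ℕ) (k : ℤ) : {m : Fin d →₀ ℕ | (m.degree : ℤ) ≤ k} =
    (Finset.range (k + 1).toNat).biUnion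
      fun i => (Finset.univ : Finset (Fin d)).finsuppAntidiag i := by
  ext m
  simp only [Set.mem_ofPred_eq, Finset.mem_coe, Finset.mem_biUnion, Finset.mem_range,
    mem_finsuppAntidiag_univ, exists_eq_right']
  omega

lemma degree_eq_set_eq (d : ℕ) (k : ℤ) : {m : Fin d →₀ ℕ | (m.degree : ℤ) = k} =
    (((Finset.range (k + 1).toNat).filter fun i : ℕ => (i : ℤ) = k).biUnion
      fun i => (Finset.univ : Finset (Fin d)).finsuppAntidiag i : Finset _) := by
  ext m
  simp only [Set.mem_ofPred_eq, Finset.mem_coe, Finset.mem_biUnion, Finset.mem_range,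
    mem_finsuppAntidiag_univ, exists_eq_right', Finset.mem_filter]
  omega

lemma card_biUnion_finsuppAntidiag (s : Finset ℕ) :
    (s.biUnion fun i => (Finset.univ : Finset (Fin d)).finsuppAntidiag i).card =
      ∑ i ∈ s, (d + i - 1).choose i := by
  rw [Finset.card_biUnion]
  · simp [Finset.card_finsuppAntidiag_nat_eq_choose]
  · intro i _ j _ hij
    change Disjoint _ _
    rw [Finset.disjoint_left]
    intro m hm hm'
    rw [mem_finsuppAntidiag_univ] at hm hm'
    exact hij (hm.symm.trans hm')

instance : Module.Finite ℝ (polyLE d k) := (finite_of_eq_coe (degree_le_set_eq d k)).1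

instance : Module.Finite ℝ (polyHom d k) := (finite_of_eq_coe (degree_eq_set_eq d k)).1

lemma finrank_polyLE (d : ℕ) (k : ℤ) :
    Module.finrank ℝ (polyLE d k) = ∑ i ∈ Finset.range (k + 1).toNat, (d + i - 1).choose i :=
  (finite_of_eq_coe (degree_le_set_eq d k)).2.trans (card_biUnion_finsuppAntidiag _)

lemma finrank_polyHom (d : ℕ) (k : ℤ) :
    Module.finrank ℝ (polyHom d k) =
      ∑ i ∈ (Finset.range (k + 1).toNat).filter fun i : ℕ => (i : ℤ) = k, (d + i - 1).choose i :=
  (finite_of_eq_coe (degree_eq_set_eq d k)).2.trans (card_biUnion_finsuppAntidiag _)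

lemma finrank_polyHom_natCast (d n : ℕ) :
    Module.finrank ℝ (polyHom d n) = (d + n - 1).choose n := by
  rw [finrank_polyHom, Finset.sum_eq_single n]
  · intro i hi hne
    simp only [Finset.mem_filter, Nat.cast_inj] at hi
    exact absurd hi.2 hne
  · intro h
    simp at h

lemma finrank_polyHom_of_neg (d : ℕ) (h : k < 0) : Module.finrank ℝ (polyHom d k) = 0 := by
  rw [finrank_polyHom, Int.toNat_of_nonpos (by omega)]
  simp

lemma two_mul_choose (i : ℕ) : 2 * (3 + i - 1).choose i = (i + 1) * (i + 2) := by
  have h : (3 + i - 1).choose i = (i + 2).choose 2 := by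
    rw [show 3 + i - 1 = i + 2 by omega, Nat.choose_symm_add]
  have h2 := Nat.add_one_mul_choose_eq (i + 1) 1
  rw [Nat.choose_one_right] at h2
  rw [h, mul_comm 2]
  linarith

/-- Writing the degree as n - 1 with n natural includes degree -1, the zero space, in the same
formula; the following lemmas do likewise and clear denominators. -/
lemma finrank_polyLE_one (n : ℕ) : Module.finrank ℝ (polyLE 1 ((n : ℤ) - 1)) = n := by
  rw [finrank_polyLE]
  simp

lemma finrank_polyLE_two (n : ℕ) :
    2 * Module.finrank ℝ (polyLE 2 ((n : ℤ) - 1)) = n * (n + 1) := by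
  rw [finrank_polyLE, sub_add_cancel, Int.toNat_natCast]
  induction n with
  | zero => simp
  | succ n ih =>
    have : (2 + n - 1).choose n = n + 1 := by
      rw [show 2 + n - 1 = n + 1 by omega, Nat.choose_succ_self_right]
    rw [Finset.sum_range_succ, mul_add, ih, this]; ring

lemma finrank_polyLE_three (n : ℕ) :
    6 * Module.finrank ℝ (polyLE 3 ((n : ℤ) - 1)) = n * (n + 1) * (n + 2) := by
  rw [finrank_polyLE, sub_add_cancel, Int.toNat_natCast]
  induction n with
  | zero => simp
  | succ n ih =>
    have := two_mul_choose n
    rw [Finset.sum_range_succ, mul_add, ih]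
    linarith

lemma finrank_polyHom_two (n : ℕ) : Module.finrank ℝ (polyHom 2 ((n : ℤ) - 1)) = n := by
  rcases n with _ | n
  · exact finrank_polyHom_of_neg _ (by simp)
  · rw [Nat.cast_succ, add_sub_cancel_right, finrank_polyHom_natCast,
      show 2 + n - 1 = n + 1 by omega, Nat.choose_succ_self_right]

lemma finrank_polyHom_three (n : ℕ) :
    2 * Module.finrank ℝ (polyHom 3 ((n : ℤ) - 1)) = n * (n + 1) := by
  rcases n with _ | n
  · rw [finrank_polyHom_of_neg _ (by simp)]
  · rw [Nat.cast_succ, add_sub_cancel_right, finrank_polyHom_natCast, two_mul_choose]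

lemma polyLE_le_sup (k : ℤ) : polyLE d k ≤ polyLE d (k - 1) ⊔ polyHom d k :=
  polyLE_le fun m hm => by
    by_cases h : (m.degree : ℤ) = k
    · exact Submodule.mem_sup_right ((monomial_mem_restrictSupport ℝ).2 (Or.inl h))
    · exact Submodule.mem_sup_left (monomial_mem_polyLE (by omega) 1)

variable {V : Type*} [AddCommGroup V] [Module ℝ V]

/-- Only the top degree part of `polyLE` contributes new elements to a sum. -/
lemma sup_map_polyLE {F : Submodule ℝ V} [Module.Finite ℝ F] {M : MvPolynomial (Fin d) ℝ →ₗ[ℝ] V}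
    (h : (polyLE d (k - 1)).map M ≤ F) : Module.Finite ℝ ↥(F ⊔ (polyLE d k).map M) ∧
      Module.finrank ℝ ↥(F ⊔ (polyLE d k).map M) ≤
        Module.finrank ℝ F + Module.finrank ℝ (polyHom d k) := by
  have h1 : F ⊔ (polyLE d k).map M ≤ F ⊔ (polyHom d k).map M := by
    refine sup_le le_sup_left ((Submodule.map_mono (polyLE_le_sup k)).trans ?_)
    rw [Submodule.map_sup]
    exact sup_le_sup_right h _
  have h2 : Module.Finite ℝ ↥(F ⊔ (polyHom d k).map M) := inferInstance
  refine ⟨Submodule.finiteDimensional_of_le h1, (Submodule.finrank_mono h1).trans ?_⟩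
  exact (Submodule.finrank_add_le_finrank_add_finrank _ _).trans
    (Nat.add_le_add_left (Submodule.finrank_map_le M _) _)

end Dimension

/-! ### Dimensions of the spaces of fields and test fields. -/

section SpaceDimension

variable {d : ℕ} {k : ℤ} (s : Affine.Simplex ℝ E3 d)

instance : Module.Finite ℝ (polyFun k (body s)) := by
  rw [← map_simplexFun]; infer_instance

lemma finrank_polyFun : Module.finrank ℝ (polyFun k (body s)) = Module.finrank ℝ (polyLE d k) := by
  rw [← map_simplexFun]
  exact (Submodule.equivMapOfInjective _ (simplexFun_injective s) _).finrank_eq.symm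

/-- The tangential field with the given polynomial components in the affine frame. -/
noncomputable def frameMap (k : ℤ) : (Fin d → polyLE d k) →ₗ[ℝ] (body s → E3) where
  toFun A := fun x => ∑ i, simplexFun s (A i : MvPolynomial (Fin d) ℝ) x • edgeVec s i
  map_add' A B := by
    ext1 x; simp [add_smul, Finset.sum_add_distrib]
  map_smul' c A := by
    ext1 x; simp [Finset.smul_sum, smul_smul]

lemma frameMap_apply (A : Fin d → polyLE d k) (x : body s) :
    frameMap s k A x = simplexLin s fun i => simplexFun s (A i : MvPolynomial (Fin d) ℝ) x := rfl

lemma frameMap_injective : Function.Injective (frameMap s k) := by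
  intro A B h
  ext1 i
  refine Subtype.ext (simplexFun_injective s (funext fun x => ?_))
  have := congrFun h x
  rw [frameMap_apply, frameMap_apply] at this
  exact congrFun (simplexLin_injective s this) i

/-- The coordinates of a tangential field in the frame come from a constant linear left inverse, so
they are polynomials of the same degree. -/
lemma range_frameMap : LinearMap.range (frameMap s k) =
    polyField k (body s) ⊓ fieldsIn (tangentDir s) (body s) := by
  apply le_antisymm
  · rintro _ ⟨A, rfl⟩
    refine ⟨sum_simplexFun_smul_mem s (fun i => (A i).2) _, fun x => ?_⟩
    rw [frameMap_apply, ← range_simplexLin]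
    exact ⟨_, rfl⟩
  · rintro v ⟨hv, ht⟩
    obtain ⟨Q, hQ, hvQ⟩ := exists_vecField hv
    let A : Fin d → polyLE d k := fun i =>
      ⟨pullPoly s (∑ l, simplexLinInv s (EuclideanSpace.single l 1) i • Q l), pullPoly_mem s
        (Submodule.sum_mem _ fun l _ => Submodule.smul_mem _ _ (hQ l))⟩
    refine ⟨A, funext fun x => ?_⟩
    have hx := ht x
    rw [← range_simplexLin] at hx
    obtain ⟨w, hw⟩ := hx
    rw [frameMap_apply, ← hw]
    congr 1
    rw [← simplexLinInv_simplexLin s w, hw, hvQ]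
    ext i
    have e : vecField Q x = ∑ l, eval (fun m => x.1 m) (Q l) • (EuclideanSpace.single l 1 : E3) := by
      ext m; simp [vecField, Pi.single_apply]
    rw [simplexFun_pullPoly, e]
    simp [smul_eval, mul_comm]

instance : Module.Finite ℝ ↥(polyField k (body s) ⊓ fieldsIn (tangentDir s) (body s)) := by
  rw [← range_frameMap]; infer_instance

lemma finrank_tangentField :
    Module.finrank ℝ ↥(polyField k (body s) ⊓ fieldsIn (tangentDir s) (body s)) =
      d * Module.finrank ℝ (polyLE d k) := by
  rw [← range_frameMap, LinearMap.finrank_range_of_inj (frameMap_injective s),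
    Module.finrank_pi_fintype]
  simp

lemma tangentField_eq (t : Affine.Simplex ℝ E3 3) :
    polyField k (body t) ⊓ fieldsIn (tangentDir t) (body t) = polyField k (body t) := by
  have htop : tangentDir t = ⊤ :=
    Submodule.eq_top_of_finrank_eq (by rw [finrank_tangentDir]; simp)
  refine inf_eq_left.2 fun v _ x => ?_
  rw [htop]; exact Submodule.mem_top

instance (t : Affine.Simplex ℝ E3 3) : Module.Finite ℝ (polyField k (body t)) := by
  rw [← tangentField_eq]; infer_instance

lemma finrank_polyField (t : Affine.Simplex ℝ E3 3) :
    Module.finrank ℝ (polyField k (body t)) = 3 * Module.finrank ℝ (polyLE 3 k) := by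
  rw [← tangentField_eq, finrank_tangentField]

/-- For B of degree at most r - 2, the field B ν × (x - x_0) is tangential of degree at most r - 1,
so it already lies in the first summand. Only the top-degree part of B can add dimensions; the
Raviart-Thomas bound is obtained in the same way. -/
lemma nedelecFace_finrank (r : ℤ) {f : Affine.Simplex ℝ E3 2} {ν : E3} (hν : ‖ν‖ = 1)
    (hn : ν ∈ (tangentDir f)ᗮ) : Module.Finite ℝ (nedelecFace r f ν) ∧
      Module.finrank ℝ (nedelecFace r f ν) ≤
        2 * Module.finrank ℝ (polyLE 2 (r - 1)) + Module.finrank ℝ (polyHom 2 (r - 1)) := by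
  rw [nedelecFace, ← map_simplexFun, ← Submodule.map_comp, ← finrank_tangentField f]
  refine sup_map_polyLE ?_
  rintro _ ⟨B, hB, rfl⟩
  have e : ((mulField fun x : body f => cross ν (x.1 - f.points 0)).comp (simplexFun f)) B =
      fun x => ∑ i, simplexFun f (X i * B) x • (-cross (edgeVec f i) ν) := by
    ext1 x
    have h1 := sum_simplexFun_radial (s := f) 0 B x
    simp only [Pi.zero_apply, zero_add, map_zero, zero_smul, Finset.sum_const_zero] at h1
    have h2 := congrArg (crossRight ν) h1
    simp only [map_sum, map_smul, crossRight_apply] at h2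
    simp only [smul_neg, Finset.sum_neg_distrib, h2]
    rw [← smul_neg, ← cross_anticomm_E3]
    rfl
  rw [e]
  refine ⟨sum_simplexFun_smul_mem f (fun i => ?_) _, fun x => Submodule.sum_mem _ fun i _ =>
    Submodule.smul_mem _ _ (Submodule.neg_mem _
      (mem_tangentDir_of_inner_eq_zero hν hn (inner_cross_right _ _)))⟩
  have := mul_mem_polyLE (X_mem_polyLE i le_rfl) hB
  rwa [add_sub_cancel] at this

lemma raviartThomas_finrank (r : ℤ) (t : Affine.Simplex ℝ E3 3) :
    Module.Finite ℝ (raviartThomas r t) ∧ Module.finrank ℝ (raviartThomas r t) ≤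
      3 * Module.finrank ℝ (polyLE 3 (r - 1)) + Module.finrank ℝ (polyHom 3 (r - 1)) := by
  rw [raviartThomas, ← map_simplexFun, ← Submodule.map_comp, ← finrank_polyField t]
  refine sup_map_polyLE ?_
  rintro _ ⟨B, hB, rfl⟩
  have e : ((mulField fun x : body t => x.1).comp (simplexFun t)) B =
      (fun x => ∑ i, simplexFun t (X i * B) x • edgeVec t i) +
        fun x => ∑ _i : Fin 1, simplexFun t B x • t.points 0 := by
    ext1 x
    have h1 := sum_simplexFun_radial (s := t) 0 B x
    simp only [Pi.zero_apply, zero_add, map_zero, zero_smul, Finset.sum_const_zero] at h1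
    simp [h1, mulField, smul_sub]
  rw [e]
  refine Submodule.add_mem _ (sum_simplexFun_smul_mem t (fun i => ?_) _)
    (sum_simplexFun_smul_mem t (fun _ => polyLE_mono (by omega) hB) _)
  have := mul_mem_polyLE (X_mem_polyLE i le_rfl) hB
  rwa [add_sub_cancel] at this

end SpaceDimension

/-! ### Continuity and integrability of the integrands. -/

section Continuity

variable {d : ℕ} {k : ℤ} {s : Affine.Simplex ℝ E3 d}

lemma continuous_of_mem_polyFun {g : body s → ℝ} (hg : g ∈ polyFun k (body s)) :
    Continuous g := by
  rw [← map_simplexFun] at hg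
  obtain ⟨q, -, rfl⟩ := hg
  exact (continuous_eval_poly q).comp (continuous_simplexInv s)

lemma continuous_of_mem_polyField {u : body s → E3} (hu : u ∈ polyField k (body s)) :
    Continuous u := by
  have h : Continuous fun x => (u x).ofLp := continuous_pi fun i => continuous_of_mem_polyFun (hu i)
  exact (PiLp.continuous_toLp 2 _).comp h

lemma continuous_mulField {w : body s → E3} (hw : Continuous w) {u : body s → E3}
    (hu : u ∈ (polyFun k (body s)).map (mulField w)) : Continuous u := by
  obtain ⟨b, hb, rfl⟩ := hu
  exact (continuous_of_mem_polyFun hb).smul hw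

lemma continuous_cross : Continuous fun x : E3 × E3 => cross x.1 x.2 := by
  have h : Continuous fun x : E3 × E3 => x.1.ofLp ⨯₃ x.2.ofLp := by
    refine continuous_pi fun i => ?_
    fin_cases i <;> simp [cross_apply] <;> fun_prop
  exact (PiLp.continuous_toLp 2 _).comp h

lemma continuous_of_mem_nedelecFace {r : ℤ} {f : Affine.Simplex ℝ E3 2} {ν : E3}
    {ω : body f → E3} (hω : ω ∈ nedelecFace r f ν) : Continuous ω := by
  obtain ⟨a, ha, b, hb, rfl⟩ := Submodule.mem_sup.1 hω
  refine (continuous_of_mem_polyField ha.1).add (continuous_mulField ?_ hb)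
  exact continuous_cross.comp (continuous_const.prodMk
    (continuous_subtype_val.sub continuous_const))

lemma continuous_of_mem_raviartThomas {r : ℤ} {t : Affine.Simplex ℝ E3 3}
    {η : body t → E3} (hη : η ∈ raviartThomas r t) : Continuous η := by
  obtain ⟨a, ha, b, hb, rfl⟩ := Submodule.mem_sup.1 hη
  exact (continuous_of_mem_polyField ha).add (continuous_mulField continuous_subtype_val hb)

lemma integrable_of_continuous {g : body s → ℝ} (hg : Continuous g) :
    Integrable g (μHE[d] : Measure (body s)) := by
  have : CompactSpace (body s) := isCompact_iff_compactSpace.1 s.isCompact_closedInterior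
  exact hg.integrable_of_hasCompactSupport (HasCompactSupport.of_compactSpace _)

end Continuity

/-! ### The degrees of freedom as linear maps. -/

section Functionals

variable (t : Affine.Simplex ℝ E3 3) (k l : ℤ)

/-- The edge degrees of freedom as a bilinear map. -/
noncomputable def edgeDofLin (e : EdgeIdx) (τ : E3) :
    polyField k (body t) →ₗ[ℝ] Module.Dual ℝ (polyFun l (body (edge t e))) :=
  have hi : ∀ (u : polyField k (body t)) (q : polyFun l (body (edge t e))),
      Integrable (fun x => inner ℝ (u.1 (edgeIncl t e x)) τ * q.1 x)
        (μHE[1] : Measure (body (edge t e))) := fun u q =>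
    integrable_of_continuous ((((continuous_of_mem_polyField u.2).comp
      (continuous_inclusion (t.closedInterior_face_subset_closedInterior e.2))).inner
        continuous_const).mul (continuous_of_mem_polyFun q.2))
  LinearMap.mk₂ ℝ (fun u q => edgeDof t u e τ q)
    (fun u v q => by
      simp only [edgeDof]
      rw [← integral_add (hi u q) (hi v q)]
      simp only [Submodule.coe_add, Pi.add_apply, inner_add_left, add_mul])
    (fun c u q => by
      simp only [edgeDof, smul_eq_mul]
      rw [← integral_const_mul]
      simp only [Submodule.coe_smul, Pi.smul_apply, real_inner_smul_left, mul_assoc])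
    (fun u q r => by
      simp only [edgeDof]
      rw [← integral_add (hi u q) (hi u r)]
      simp only [Submodule.coe_add, Pi.add_apply, mul_add])
    (fun c u q => by
      simp only [edgeDof, smul_eq_mul]
      rw [← integral_const_mul]
      simp only [Submodule.coe_smul, Pi.smul_apply, smul_eq_mul, mul_left_comm])

/-- The face degrees of freedom as a bilinear map. -/
noncomputable def faceDofLin (f : FaceIdx) (ν : E3) :
    polyField k (body t) →ₗ[ℝ] Module.Dual ℝ (nedelecFace l (face t f) ν) :=
  have hi : ∀ (u : polyField k (body t)) (ω : nedelecFace l (face t f) ν),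
      Integrable (fun x => inner ℝ (cross (u.1 (faceIncl t f x)) ν) (ω.1 x))
        (μHE[2] : Measure (body (face t f))) := fun u ω =>
    integrable_of_continuous ((continuous_cross.comp (((continuous_of_mem_polyField u.2).comp
      (continuous_inclusion (t.closedInterior_face_subset_closedInterior f.2))).prodMk continuous_const)).inner
        (continuous_of_mem_nedelecFace ω.2))
  LinearMap.mk₂ ℝ (fun u ω => faceDof t u f ν ω)
    (fun u v q => by
      simp only [faceDof]
      rw [← integral_add (hi u q) (hi v q)]
      simp only [Submodule.coe_add, Pi.add_apply, ← crossRight_apply, map_add, inner_add_left])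
    (fun c u q => by
      simp only [faceDof, smul_eq_mul]
      rw [← integral_const_mul]
      simp only [Submodule.coe_smul, Pi.smul_apply, ← crossRight_apply, map_smul,
        real_inner_smul_left])
    (fun u q r => by
      simp only [faceDof]
      rw [← integral_add (hi u q) (hi u r)]
      simp only [Submodule.coe_add, Pi.add_apply, inner_add_right])
    (fun c u q => by
      simp only [faceDof, smul_eq_mul]
      rw [← integral_const_mul]
      simp only [Submodule.coe_smul, Pi.smul_apply, real_inner_smul_right])

/-- The interior degrees of freedom as a bilinear map. -/
noncomputable def cellDofLin :
    polyField k (body t) →ₗ[ℝ] Module.Dual ℝ (raviartThomas l t) :=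
  have hi : ∀ (u : polyField k (body t)) (η : raviartThomas l t),
      Integrable (fun x => inner ℝ (u.1 x) (η.1 x)) (volume.comap Subtype.val) := fun u η => by
    rw [comap_volume_eq]
    exact integrable_of_continuous ((continuous_of_mem_polyField u.2).inner
      (continuous_of_mem_raviartThomas η.2))
  LinearMap.mk₂ ℝ (fun u η => cellDof t u η)
    (fun u v q => by
      simp only [cellDof]
      rw [← integral_add (hi u q) (hi v q)]
      simp only [Submodule.coe_add, Pi.add_apply, inner_add_left])
    (fun c u q => by
      simp only [cellDof, smul_eq_mul]
      rw [← integral_const_mul]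
      simp only [Submodule.coe_smul, Pi.smul_apply, real_inner_smul_left])
    (fun u q r => by
      simp only [cellDof]
      rw [← integral_add (hi u q) (hi u r)]
      simp only [Submodule.coe_add, Pi.add_apply, inner_add_right])
    (fun c u q => by
      simp only [cellDof, smul_eq_mul]
      rw [← integral_const_mul]
      simp only [Submodule.coe_smul, Pi.smul_apply, real_inner_smul_right])

/-- The vertex degrees of freedom as a linear map. -/
def vertexDofLin : polyField k (body t) →ₗ[ℝ] (Fin 4 → E3) where
  toFun u := vertexDof t u
  map_add' _ _ := rfl
  map_smul' _ _ := rfl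

/-- All degrees of freedom. -/
noncomputable def dofLin (τ : EdgeIdx → E3) (ν : FaceIdx → E3) :
    polyField k (body t) →ₗ[ℝ] (Fin 4 → E3) ×
      (∀ e : EdgeIdx, Module.Dual ℝ (polyFun (k - 2) (body (edge t e)))) ×
      (∀ f : FaceIdx, Module.Dual ℝ (nedelecFace (k - 1) (face t f) (ν f))) ×
      Module.Dual ℝ (raviartThomas (k - 2) t) :=
  (vertexDofLin t k).prod ((LinearMap.pi fun e => edgeDofLin t k (k - 2) e (τ e)).prod
    ((LinearMap.pi fun f => faceDofLin t k (k - 1) f (ν f)).prod (cellDofLin t k (k - 2))))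

end Functionals

/-! ### Injectivity and the dimension count. -/

section Main

variable {t : Affine.Simplex ℝ E3 3} {τ : EdgeIdx → E3} {ν : FaceIdx → E3}

lemma dofLin_injective {k : ℤ} (hk : 0 ≤ k)
    (hτ : ∀ e, ‖τ e‖ = 1 ∧ τ e ∈ tangentDir (edge t e))
    (hν : ∀ f, ‖ν f‖ = 1 ∧ ν f ∈ (tangentDir (face t f))ᗮ) :
    Function.Injective (dofLin t k τ ν) := by
  rw [← LinearMap.ker_eq_bot, LinearMap.ker_eq_bot']
  intro u hu
  obtain ⟨Q, hQ, huQ⟩ := exists_vecField u.2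
  obtain ⟨h1, h2⟩ := Prod.ext_iff.1 hu
  obtain ⟨h2, h3⟩ := Prod.ext_iff.1 h2
  obtain ⟨h3, h4⟩ := Prod.ext_iff.1 h3
  have he : ∀ e, TangentZero (edge t e) Q := fun e =>
    tangentZero_edge hQ huQ (hτ e) (fun i => congrFun h1 i)
      fun q hq => LinearMap.congr_fun (congrFun h2 e) ⟨q, hq⟩
  have hf : ∀ f, TangentZero (face t f) Q := fun f =>
    tangentZero_face hk hQ huQ (hν f) he
      fun ω hω => LinearMap.congr_fun (congrFun h3 f) ⟨ω, hω⟩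
  exact Subtype.ext (eq_zero_of_cell hk hQ huQ hf
    fun η hη => LinearMap.congr_fun h4 ⟨η, hη⟩)

lemma dofLin_bijective {p : ℕ} (hp : 1 ≤ p)
    (hτ : ∀ e, ‖τ e‖ = 1 ∧ τ e ∈ tangentDir (edge t e))
    (hν : ∀ f, ‖ν f‖ = 1 ∧ ν f ∈ (tangentDir (face t f))ᗮ) :
    Function.Bijective (dofLin t p τ ν) := by
  have hinj := dofLin_injective (Int.natCast_nonneg p) hτ hν
  have hNf := fun f => (nedelecFace_finrank ((p : ℤ) - 1) (hν f).1 (hν f).2).1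
  have hR := (raviartThomas_finrank ((p : ℤ) - 2) t).1
  have i1 : Module.Finite ℝ
      (∀ e : EdgeIdx, Module.Dual ℝ (polyFun ((p : ℤ) - 2) (body (edge t e)))) := Module.Finite.pi
  have i2 : Module.Finite ℝ
      (∀ f : FaceIdx, Module.Dual ℝ (nedelecFace ((p : ℤ) - 1) (face t f) (ν f))) :=
    Module.Finite.pi
  have i3 := Module.Finite.prod (R := ℝ)
    (M := ∀ f : FaceIdx, Module.Dual ℝ (nedelecFace ((p : ℤ) - 1) (face t f) (ν f)))
    (N := Module.Dual ℝ (raviartThomas ((p : ℤ) - 2) t))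
  have i4 := @Module.Finite.prod ℝ _ _ _ _ _ _ _ i1 i3
  have i5 := @Module.Finite.prod ℝ (Fin 4 → E3) _ _ _ _ _ _ inferInstance i4
  -- Injectivity bounds dim P_p(t)³ by the dimension of the target; the reverse bound is the count
  -- below.
  refine ⟨hinj, (LinearMap.injective_iff_surjective_of_finrank_eq_finrank
    (le_antisymm (LinearMap.finrank_le_finrank_of_injective hinj) ?_)).1 hinj⟩
  have hN := fun f => (nedelecFace_finrank ((p : ℤ) - 1) (hν f).1 (hν f).2).2
  have hRT := (raviartThomas_finrank ((p : ℤ) - 2) t).2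
  have hE : Fintype.card EdgeIdx = 6 := by decide
  have hF : Fintype.card FaceIdx = 4 := by decide
  simp only [Module.finrank_prod, Module.finrank_pi_fintype, Subspace.dual_finrank_eq,
    finrank_polyFun, finrank_polyField, finrank_euclideanSpace_fin, Finset.sum_const,
    Finset.card_univ, hE, Fintype.card_fin, smul_eq_mul]
  have hNs := Finset.sum_le_sum fun f (_ : f ∈ (Finset.univ : Finset FaceIdx)) => hN f
  rw [Finset.sum_const, Finset.card_univ, hF, smul_eq_mul] at hNs
  -- With n = p - 1 the count is 12 + 6n + 4n(n + 2) + (n - 1)n(n + 2)/2 = (n + 2)(n + 3)(n + 4)/2,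
  -- which is dim P_p(t)³.
  obtain ⟨n, rfl⟩ : ∃ n, p = n + 1 := ⟨p - 1, by omega⟩
  have c1 : ((n + 1 : ℕ) : ℤ) - 2 = (n : ℤ) - 1 := by push_cast; ring
  have c2 : ((n + 1 : ℕ) : ℤ) - 1 - 1 = (n : ℤ) - 1 := by push_cast; ring
  have c3 : ((n + 1 : ℕ) : ℤ) = ((n + 2 : ℕ) : ℤ) - 1 := by push_cast; ring
  have a1 := finrank_polyLE_one n
  have a2 := finrank_polyLE_two n
  have a3 := finrank_polyLE_three (n + 2)
  have a4 := finrank_polyHom_two n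
  rw [← c1] at a1
  rw [← c2] at a2 a4
  rw [← c3] at a3
  -- For p = 1 the interior degree p - 3 = -2 lies outside the range m - 1 of the dimension
  -- formulas.
  rcases n with _ | m
  · have z1 : Module.finrank ℝ (polyLE 3 (((0 + 1 : ℕ) : ℤ) - 2 - 1)) = 0 := by
      rw [finrank_polyLE]; simp
    have z2 : Module.finrank ℝ (polyHom 3 (((0 + 1 : ℕ) : ℤ) - 2 - 1)) = 0 :=
      finrank_polyHom_of_neg _ (by norm_num)
    linarith
  · have c4 : ((m + 1 + 1 : ℕ) : ℤ) - 2 - 1 = (m : ℤ) - 1 := by push_cast; ring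
    have b3 := finrank_polyLE_three m
    have b4 := finrank_polyHom_three m
    rw [← c4] at b3 b4
    linarith

end Main

end HermiteCurl

theorem mainTheorem5 (p : ℕ) (hp : 1 ≤ p)
    (t : Affine.Simplex ℝ HermiteCurl.E3 3)
    (τ : HermiteCurl.EdgeIdx → HermiteCurl.E3)
    (hτ : ∀ e, ‖τ e‖ = 1 ∧ τ e ∈ HermiteCurl.tangentDir (HermiteCurl.edge t e))
    (ν : HermiteCurl.FaceIdx → HermiteCurl.E3)
    (hν : ∀ f, ‖ν f‖ = 1 ∧ ν f ∈ (HermiteCurl.tangentDir (HermiteCurl.face t f))ᗮ)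
    (a : Fin 4 → HermiteCurl.E3)
    (b : ∀ e : HermiteCurl.EdgeIdx, Module.Dual ℝ
      (HermiteCurl.polyFun ((p : ℤ) - 2) (HermiteCurl.body (HermiteCurl.edge t e))))
    (c : ∀ f : HermiteCurl.FaceIdx, Module.Dual ℝ
      (HermiteCurl.nedelecFace ((p : ℤ) - 1) (HermiteCurl.face t f) (ν f)))
    (d : Module.Dual ℝ (HermiteCurl.raviartThomas ((p : ℤ) - 2) t)) :
    ∃! u : HermiteCurl.polyField (p : ℤ) (HermiteCurl.body t),
      (∀ i, HermiteCurl.vertexDof t u i = a i) ∧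
      (∀ e, ∀ q : HermiteCurl.polyFun ((p : ℤ) - 2)
          (HermiteCurl.body (HermiteCurl.edge t e)),
        HermiteCurl.edgeDof t u e (τ e) q = b e q) ∧
      (∀ f, ∀ ω : HermiteCurl.nedelecFace ((p : ℤ) - 1) (HermiteCurl.face t f) (ν f),
        HermiteCurl.faceDof t u f (ν f) ω = c f ω) ∧
      (∀ η : HermiteCurl.raviartThomas ((p : ℤ) - 2) t, HermiteCurl.cellDof t u η = d η) := by
  obtain ⟨u, hu, huniq⟩ := (HermiteCurl.dofLin_bijective hp hτ hν).existsUnique (a, b, c, d)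
  have key : ∀ v : HermiteCurl.polyField (p : ℤ) (HermiteCurl.body t),
      HermiteCurl.dofLin t p τ ν v = (a, b, c, d) ↔
      (∀ i, HermiteCurl.vertexDof t v i = a i) ∧
      (∀ e, ∀ q : HermiteCurl.polyFun ((p : ℤ) - 2)
          (HermiteCurl.body (HermiteCurl.edge t e)),
        HermiteCurl.edgeDof t v e (τ e) q = b e q) ∧
      (∀ f, ∀ ω : HermiteCurl.nedelecFace ((p : ℤ) - 1) (HermiteCurl.face t f) (ν f),
        HermiteCurl.faceDof t v f (ν f) ω = c f ω) ∧
      (∀ η : HermiteCurl.raviartThomas ((p : ℤ) - 2) t, HermiteCurl.cellDof t v η = d η) := by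
    intro v
    rw [Prod.ext_iff, Prod.ext_iff, Prod.ext_iff]
    refine and_congr funext_iff (and_congr ?_ (and_congr ?_ ?_))
    · exact funext_iff.trans (forall_congr' fun e => LinearMap.ext_iff)
    · exact funext_iff.trans (forall_congr' fun f => LinearMap.ext_iff)
    · exact LinearMap.ext_iff
  exact ⟨u, (key u).1 hu, fun v hv => huniq v ((key v).2 hv)⟩
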